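/- All graphs are finite and simple; $\Delta(G)$ and $\delta(G)$ denote the maximum and minimum degree of $G$. A proper total colouring of $G=(V,E)$ is a map $c:V\cup E\to\{1,\dots,k\}$ such that adjacent vertices get different colours, distinct edges with a common endpoint get different colours, and no edge gets the same colour as one of its endpoints. The pallet of $v\in V$ is $S_c(v)=\{c(v)\}\cup\{c(e): e\in E,\ v\in e\}$. For a positive integer $r$, let $\chi''_{a,r}(G)$ be the least $k$ for which $G$ has a proper total colouring $c$ with $k$ colours such that $S_c(u)\neq S_c(v)$ for all $u,v\in V$ with $1\le d(u,v)\le r$, where $d$ is the distance in $G$. **Theorem.** Let $r\ge 2$ be an integer. (i) There is $\Delta_0$ such that for every graph $G$ with maximum degree $\Delta=\Delta(G)\ge\Delta_0$ and $\delta(G)\ge r+2$, $$\chi''_{a,r}(G)\le\left\lceil\frac{\Delta}{(\ln\Delta)^4}\right\rceil\left(\lceil(\ln\Delta)^4\rceil+5\lceil(\ln\Delta)^3\rceil+2\right).$$ (ii) Hence, for all graphs $G$ of maximum degree $\Delta$ with $\delta(G)\ge r+2$, $\chi''_{a,r}(G)=(1+o(1))\Delta$ as $\Delta\to\infty$; that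 is, for every $\varepsilon>0$ there is $\Delta_1$ such that $|\chi''_{a,r}(G)-\Delta|\le\varepsilon\Delta$ for every graph $G$ with maximum degree $\Delta\ge\Delta_1$ and $\delta(G)\ge r+2$. -/

import Mathlib

universe u

namespace SimpleGraph

variable {V : Type u} (G : SimpleGraph V)

/-- `c : V ∪ E → α` is a proper total colouring of `G`: adjacent vertices, distinct edges with a
common endpoint, and an edge and each of its endpoints get different colours. -/
structure IsProperTotalColouring {α : Type*} (c : V ⊕ G.edgeSet → α) : Prop where
  vertex_ne : ∀ u v : V, G.Adj u v → c (Sum.inl u) ≠ c (Sum.inl v)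
  edge_ne : ∀ e f : G.edgeSet, e ≠ f → (∃ v : V, v ∈ e.1 ∧ v ∈ f.1) →
    c (Sum.inr e) ≠ c (Sum.inr f)
  incident_ne : ∀ (v : V) (e : G.edgeSet), v ∈ e.1 → c (Sum.inl v) ≠ c (Sum.inr e)

/-- The pallet `S_c(v)`: the colours of the edges incident with `v`, together with that of `v`. -/
def totalPallet {α : Type*} (c : V ⊕ G.edgeSet → α) (v : V) : Set α :=
  {a | ∃ e : G.edgeSet, v ∈ e.1 ∧ c (Sum.inr e) = a} ∪ {c (Sum.inl v)}

/-- `u` and `v` are `r`-neighbours: `1 ≤ d(u, v) ≤ r` (with `d(u, v) = ∞` for vertices in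
different components). -/
def IsDistNeighbour (r : ℕ) (u v : V) : Prop :=
  1 ≤ G.edist u v ∧ G.edist u v ≤ (r : ℕ∞)

/-- `r`-distant set distinguishing total colourings. -/
structure IsDistSetDistinguishing (r : ℕ) {α : Type*} (c : V ⊕ G.edgeSet → α) : Prop where
  proper : G.IsProperTotalColouring c
  pallet_ne : ∀ u v : V, G.IsDistNeighbour r u v → G.totalPallet c u ≠ G.totalPallet c v

/-- `χ''_{a,r}(G)`: the least `k` for which `G` has an `r`-distant set distinguishing total
colouring with colours from a set of `k` colours. -/
noncomputable def distSetTotalNumber (r : ℕ) : ℕ :=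
  sInf {k : ℕ | ∃ c : V ⊕ G.edgeSet → Fin k, G.IsDistSetDistinguishing r c}

/-- Giving all vertices and edges pairwise different colours is always admissible. -/
theorem isDistSetDistinguishing_of_injective (r : ℕ) {α : Type*} (c : V ⊕ G.edgeSet → α)
    (hc : Function.Injective c) : G.IsDistSetDistinguishing r c where
  proper :=
    { vertex_ne := fun u v h e => h.ne (Sum.inl_injective (hc e))
      edge_ne := fun e f h _ h2 => h (Sum.inr_injective (hc h2))
      incident_ne := fun v e _ h => Sum.inl_ne_inr (hc h) }
  pallet_ne := by
    intro u v h hS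
    have hu : c (Sum.inl u) ∈ G.totalPallet c v := hS ▸ Or.inr rfl
    rcases hu with ⟨e, -, he⟩ | hu
    · exact Sum.inr_ne_inl (hc he)
    · obtain rfl : u = v := Sum.inl_injective (hc hu)
      simpa [IsDistNeighbour] using h.1

/-- For a finite graph, the minimum in the definition of `χ''_{a,r}(G)` is attained. -/
theorem exists_isDistSetDistinguishing_distSetTotalNumber [Finite V] (r : ℕ) :
    ∃ c : V ⊕ G.edgeSet → Fin (G.distSetTotalNumber r), G.IsDistSetDistinguishing r c := by
  have hne : {k : ℕ | ∃ c : V ⊕ G.edgeSet → Fin k, G.IsDistSetDistinguishing r c}.Nonempty :=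
    ⟨Nat.card (V ⊕ G.edgeSet), Finite.equivFin (V ⊕ G.edgeSet),
      G.isDistSetDistinguishing_of_injective r _ (Equiv.injective _)⟩
  exact Nat.sInf_mem hne

end SimpleGraph

/-!
The bounds follow from the existence of a distinguishing total colouring with `Δ + 6β` colours,
where `β = ⌊Δ / (2 ln Δ)⌋`, together with the fact that a vertex of degree `Δ` already needs `Δ`
colours.

**The colouring.** Let `φ` be a proper edge colouring from Vizing's theorem
(`SimpleGraph.exists_isEdgeColouring`), taken in a palette of `Δ + 3β` colours. The vertices are
coloured properly from the same palette so that every vertex `v` has at most `B` neighbours `u` with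
the colour of the edge `uv`, where `B` is of order `(ln Δ) ^ 2`
(`SimpleGraph.exists_vertexColouring`). Call a vertex low if its degree is at most `β - 2`. The
following edges are *flexible*, that is, they lose the colour given by `φ`:
* the edges with a low end vertex; such an edge meets at most `Δ + β` vertices and other
  edges, so it retains at least `2β` colours of the main palette whatever the other colours are;
* the edges whose colour under `φ` is the colour of an end vertex, and `r + 2` edges between
  non-low vertices selected at each non-low vertex with many non-low neighbours. By Hall's theorem
  (`exists_choice_card_eq`) the selection can be made so that no vertex is selected too often. These
  edges form a graph of maximum degree at most `β / 2`, so `3β` additional colours leave at least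
  `2β` choices for each of them.

Since `δ(G) ≥ r + 2`, every vertex lies on at least `r + 2` flexible edges, hence for a given
vertex `u` every vertex `v ≠ u` lies on at least `r + 1` flexible edges that avoid `u`. Once all
other colours are known, at most `(r + 1)!` of the at least `(2β) ^ (r + 1)` colourings of these
edges give `u` and `v` the same pallet, while `v` has at most `(Δ + 1) ^ r` vertices within
distance `r`. So few extensions are bad that a colouring of the flexible edges avoiding all
coincidences exists (`SimpleGraph.exists_isDistSetDistinguishing_of_lists`).

**The counting principle.** Both the vertex colouring and the colouring of the flexible edges come
from `exists_forall_not_of_counting`, in which the local lemma is replaced by a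
counting argument: one shows by induction that each further coordinate keeps at least a fraction
`β / K` of the good functions, `K` being the number of colours, because the functions spoilt by an
event with support containing the new coordinate can be counted by forgetting `t` coordinates of
that support, and by induction this costs a factor of at most `(K / β) ^ t`.
-/

/-! ### Vizing's theorem -/

namespace SimpleGraph

/-- `c` restricts to a proper edge colouring of `H`. The colours of non-edges are irrelevant. -/
def IsEdgeColouring {V κ : Type*} (H : SimpleGraph V) (c : Sym2 V → κ) : Prop :=
  ∀ a b b', H.Adj a b → H.Adj a b' → c s(a, b) = c s(a, b') → b = b'

/-- No edge of `H` at `a` has the colour `γ`. -/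
def Misses {V κ : Type*} (H : SimpleGraph V) (c : Sym2 V → κ) (a : V) (γ : κ) : Prop :=
  ∀ b, H.Adj a b → c s(a, b) ≠ γ

/-- `FanReach H c x y n w`: there is a sequence `y = w₀, …, wₙ = w` such that every `wᵢ₊₁` is a
neighbour of `x` and the colour of the edge `x wᵢ₊₁` is missing at `wᵢ`. -/
def FanReach {V κ : Type*} (H : SimpleGraph V) (c : Sym2 V → κ) (x y : V) : ℕ → V → Prop
  | 0, w => w = y
  | n + 1, w => ∃ w', FanReach H c x y n w' ∧ H.Adj x w ∧ H.Misses c w' (c s(x, w))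

section Vizing

variable {V κ : Type*} {H G : SimpleGraph V} {c : Sym2 V → κ} {x y : V}

open scoped Classical in
theorem exists_misses [Fintype V] [Fintype κ] (H : SimpleGraph V) (c : Sym2 V → κ) (a : V)
    (h : H.degree a < Fintype.card κ) : ∃ γ, H.Misses c a γ := by
  have hc : ((H.neighborFinset a).image fun b => c s(a, b)).card < (Finset.univ : Finset κ).card :=
    lt_of_le_of_lt Finset.card_image_le (by simpa using h)
  obtain ⟨γ, -, hγ⟩ := Finset.exists_mem_notMem_of_card_lt_card hc
  refine ⟨γ, fun b hb e => hγ ?_⟩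
  exact Finset.mem_image.2 ⟨b, by simpa using hb, e⟩

/-- If a colour is missing both at `x` and at the end of a fan starting at `y`, then shifting the
colours along the fan frees a colour for the uncoloured edge `xy`. -/
theorem exists_isEdgeColouring_of_fanReach (hxy : x ≠ y) (hH : ¬ H.Adj x y)
    (hG : ∀ a b, G.Adj a b → H.Adj a b ∨ s(a, b) = s(x, y)) :
    ∀ (n : ℕ) (c : Sym2 V → κ) (w : V) (γ : κ), H.IsEdgeColouring c → H.FanReach c x y n w →
      H.Misses c x γ → H.Misses c w γ → ∃ c' : Sym2 V → κ, G.IsEdgeColouring c' := by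
  classical
  intro n
  induction n using Nat.strong_induction_on with
  | _ n ih =>
  intro c w γ hc hw hx hwγ
  by_cases hmin : ∃ m < n, H.FanReach c x y m w
  · obtain ⟨m, hm, hmw⟩ := hmin
    exact ih m hm c w γ hc hmw hx hwγ
  push Not at hmin
  cases n with
  | zero =>
    obtain rfl : w = y := hw
    refine ⟨Function.update c s(x, w) γ, ?_⟩
    intro a b b' hab hab' he
    by_cases h1 : s(a, b) = s(x, w) <;> by_cases h2 : s(a, b') = s(x, w)
    · exact Sym2.congr_right.1 (h1.trans h2.symm)
    · rw [h1, Function.update_self, Function.update_of_ne h2] at he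
      have hab'' := (hG _ _ hab').resolve_right h2
      rcases Sym2.eq_iff.1 h1 with ⟨rfl, rfl⟩ | ⟨rfl, rfl⟩
      · exact absurd he.symm (hx _ hab'')
      · exact absurd he.symm (hwγ _ hab'')
    · rw [h2, Function.update_self, Function.update_of_ne h1] at he
      have hab'' := (hG _ _ hab).resolve_right h1
      rcases Sym2.eq_iff.1 h2 with ⟨rfl, rfl⟩ | ⟨rfl, rfl⟩
      · exact absurd he (hx _ hab'')
      · exact absurd he (hwγ _ hab'')
    · rw [Function.update_of_ne h1, Function.update_of_ne h2] at he
      exact hc a b b' ((hG _ _ hab).resolve_right h1) ((hG _ _ hab').resolve_right h2) he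
  | succ n =>
    obtain ⟨w', hw', hxw, hδ⟩ := hw
    have hw'w : w' ≠ w := fun h => hmin n (Nat.lt_succ_self n) (h ▸ hw')
    -- recolour `xw` by `γ`; this frees the old colour of `xw` at `x`, and `w'` misses it as well
    have hmiss : ∀ u δ, u ≠ w → u ≠ x → H.Misses c u δ →
        H.Misses (Function.update c s(x, w) γ) u δ := by
      intro u δ huw hux hu b hb
      rw [Function.update_of_ne]
      · exact hu b hb
      · intro h
        rcases Sym2.eq_iff.1 h with ⟨h, -⟩ | ⟨h, -⟩
        · exact hux h
        · exact huw h
    have hne : ∀ u v, H.Adj x v → H.Misses c u (c s(x, v)) → u ≠ x := by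
      rintro u v hv hu rfl
      exact hu v hv rfl
    refine ih n (Nat.lt_succ_self n) (Function.update c s(x, w) γ) w' (c s(x, w)) ?_ ?_ ?_
      (hmiss _ _ hw'w (hne _ _ hxw hδ) hδ)
    · intro a b b' hab hab' he
      by_cases h1 : s(a, b) = s(x, w) <;> by_cases h2 : s(a, b') = s(x, w)
      · exact Sym2.congr_right.1 (h1.trans h2.symm)
      · rw [h1, Function.update_self, Function.update_of_ne h2] at he
        rcases Sym2.eq_iff.1 h1 with ⟨rfl, rfl⟩ | ⟨rfl, rfl⟩
        · exact absurd he.symm (hx _ hab')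
        · exact absurd he.symm (hwγ _ hab')
      · rw [h2, Function.update_self, Function.update_of_ne h1] at he
        rcases Sym2.eq_iff.1 h2 with ⟨rfl, rfl⟩ | ⟨rfl, rfl⟩
        · exact absurd he (hx _ hab)
        · exact absurd he (hwγ _ hab)
      · rw [Function.update_of_ne h1, Function.update_of_ne h2] at he
        exact hc a b b' hab hab' he
    · have key : ∀ m ≤ n, ∀ u, H.FanReach c x y m u →
          H.FanReach (Function.update c s(x, w) γ) x y m u := by
        intro m
        induction m with
        | zero => exact fun _ u hu => hu
        | succ m ihm =>
          rintro hm u ⟨u', hu', hxu, hu⟩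
          have huw : u ≠ w := by
            rintro rfl
            exact hmin (m + 1) (by omega) ⟨u', hu', hxu, hu⟩
          have hu'w : u' ≠ w := by
            rintro rfl
            exact hmin m (by omega) hu'
          refine ⟨u', ihm (by omega) u' hu', hxu, ?_⟩
          rw [Function.update_of_ne (fun h => huw (Sym2.congr_right.1 h))]
          exact hmiss _ _ hu'w (hne _ _ hxu hu) hu
      exact key n le_rfl w' hw'
    · intro b hb
      by_cases hbw : b = w
      · subst hbw
        rw [Function.update_self]
        exact fun h => hx b hb h.symm
      · rw [Function.update_of_ne (fun h => hbw (Sym2.congr_right.1 h))]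
        exact fun h => hbw (hc x b w hb hxw h)

/-- The colouring obtained from `c` by exchanging the colours `α` and `β` on all edges that meet
the vertex set `C`. -/
noncomputable def kempeSwap {V κ : Type*} (c : Sym2 V → κ) (α β : κ) (C : Set V) : Sym2 V → κ :=
  open scoped Classical in fun e => if ∃ a ∈ e, a ∈ C then Equiv.swap α β (c e) else c e

/-- The vertex set `C` is a union of components of the graph of the edges of `H` with colour `α`
or `β`. -/
def IsKempeClosed {V κ : Type*} (H : SimpleGraph V) (c : Sym2 V → κ) (α β : κ) (C : Set V) :
    Prop :=
  ∀ a b, H.Adj a b → (c s(a, b) = α ∨ c s(a, b) = β) → a ∈ C → b ∈ C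

variable {α β : κ} {C : Set V}

open scoped Classical in
theorem IsKempeClosed.kempeSwap_apply (hC : H.IsKempeClosed c α β C) {a b : V} (hab : H.Adj a b) :
    kempeSwap c α β C s(a, b) =
      if a ∈ C then Equiv.swap α β (c s(a, b)) else c s(a, b) := by
  by_cases ha : a ∈ C
  · simp [kempeSwap, ha]
  · by_cases hb : b ∈ C
    · have h : ¬ (c s(a, b) = α ∨ c s(a, b) = β) := by
        intro h
        exact ha (hC b a hab.symm (by rwa [Sym2.eq_swap]) hb)
      push Not at h
      simp [kempeSwap, ha, hb, Equiv.swap_apply_of_ne_of_ne h.1 h.2]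
    · simp [kempeSwap, ha, hb]

theorem IsKempeClosed.isEdgeColouring (hC : H.IsKempeClosed c α β C) (hc : H.IsEdgeColouring c) :
    H.IsEdgeColouring (kempeSwap c α β C) := by
  classical
  intro a b b' hab hab' he
  rw [hC.kempeSwap_apply hab, hC.kempeSwap_apply hab'] at he
  split_ifs at he
  · exact hc a b b' hab hab' ((Equiv.swap α β).injective he)
  · exact hc a b b' hab hab' he

theorem IsKempeClosed.misses_of_notMem (hC : H.IsKempeClosed c α β C) {a : V} {γ : κ}
    (ha : a ∉ C) (h : H.Misses c a γ) : H.Misses (kempeSwap c α β C) a γ := by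
  classical
  intro b hb
  rw [hC.kempeSwap_apply hb, if_neg ha]
  exact h b hb

theorem IsKempeClosed.misses_of_mem [DecidableEq κ] (hC : H.IsKempeClosed c α β C) {a : V} {γ : κ}
    (ha : a ∈ C) (h : H.Misses c a γ) :
    H.Misses (kempeSwap c α β C) a (Equiv.swap α β γ) := by
  classical
  intro b hb
  rw [hC.kempeSwap_apply hb, if_pos ha]
  intro h'
  refine h b hb ((Equiv.swap α β).injective ?_)
  convert h'

/-- A connected graph with all degrees at most two has at most two vertices of degree at
most one. -/
theorem Connected.false_of_three_le_one_degree {W : Type*} [Fintype W] (K : SimpleGraph W)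
    [DecidableRel K.Adj] (hK : K.Connected) (h2 : ∀ w, K.degree w ≤ 2) {a b d : W}
    (hab : a ≠ b) (had : a ≠ d) (hbd : b ≠ d) (ha : K.degree a ≤ 1) (hb : K.degree b ≤ 1)
    (hd : K.degree d ≤ 1) : False := by
  classical
  have h1 := hK.card_vert_le_card_edgeSet_add_one
  rw [Nat.card_eq_fintype_card, Nat.card_eq_fintype_card, ← edgeFinset_card] at h1
  have hs := K.sum_degrees_eq_twice_card_edges
  have hle : ∑ w, (K.degree w + if w ∈ ({a, b, d} : Finset W) then 1 else 0) ≤ ∑ _w : W, 2 := by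
    refine Finset.sum_le_sum fun w _ => ?_
    have := h2 w
    split_ifs with hw
    · simp only [Finset.mem_insert, Finset.mem_singleton] at hw
      rcases hw with rfl | rfl | rfl <;> omega
    · omega
  rw [Finset.sum_add_distrib, ← Finset.sum_filter, Finset.filter_mem_eq_inter] at hle
  have h3 : ({a, b, d} : Finset W).card = 3 := Finset.card_eq_three.2 ⟨a, b, d, hab, had, hbd, rfl⟩
  simp only [Finset.univ_inter, Finset.sum_const, smul_eq_mul, mul_one, h3, Finset.card_univ] at hle
  omega

/-- Three vertices that each miss `α` or `β` do not lie in the same component of the subgraph of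
the edges coloured `α` or `β`. -/
theorem IsEdgeColouring.exists_isKempeClosed [Fintype V] (hc : H.IsEdgeColouring c) {p q : V}
    (α β : κ) (hxp : x ≠ p) (hxq : x ≠ q) (hpq : p ≠ q) (hx : H.Misses c x α)
    (hp : H.Misses c p β) (hq : H.Misses c q β) :
    ∃ C, H.IsKempeClosed c α β C ∧ x ∈ C ∧ ¬ (p ∈ C ∧ q ∈ C) := by
  classical
  let K : SimpleGraph V :=
    { Adj := fun a b => H.Adj a b ∧ (c s(a, b) = α ∨ c s(a, b) = β)
      symm := ⟨fun a b h => ⟨h.1.symm, by rw [Sym2.eq_swap]; exact h.2⟩⟩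
      loopless := ⟨fun a h => H.irrefl h.1⟩ }
  refine ⟨{a | K.Reachable x a}, ?_, Reachable.refl x, ?_⟩
  · intro a b hab h ha
    exact Reachable.trans ha (Adj.reachable (G := K) ⟨hab, h⟩)
  · rintro ⟨hpC, hqC⟩
    let D := K.connectedComponentMk x
    have hmem : ∀ a, K.Reachable x a → a ∈ D.supp := fun a ha =>
      ConnectedComponent.sound ha.symm
    have hconn : (K.induce D.supp).Connected := D.connected_toSimpleGraph
    have hle : ∀ (w : D.supp), (K.induce D.supp).degree w ≤ K.degree w := by
      intro w
      rw [← card_neighborFinset_eq_degree, ← card_neighborFinset_eq_degree]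
      refine Finset.card_le_card_of_injOn (fun u => u.1) ?_ (fun u _ v _ h => Subtype.ext h)
      intro u hu
      simpa using hu
    have hcol : ∀ w, (K.neighborFinset w).image (fun u => c s(w, u)) ⊆ {α, β} := by
      intro w γ hγ
      obtain ⟨u, hu, rfl⟩ := Finset.mem_image.1 hγ
      have hu : K.Adj w u := by simpa using hu
      simpa using hu.2
    have hcard : ∀ w, ((K.neighborFinset w).image (fun u => c s(w, u))).card = K.degree w := by
      intro w
      rw [Finset.card_image_of_injOn, card_neighborFinset_eq_degree]
      intro u hu v hv h
      have hu : K.Adj w u := by simpa using hu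
      have hv : K.Adj w v := by simpa using hv
      exact hc w u v hu.1 hv.1 h
    have h2 : ∀ w, K.degree w ≤ 2 := by
      intro w
      rw [← hcard]
      exact (Finset.card_le_card (hcol w)).trans Finset.card_le_two
    have h1 : ∀ w γ, (γ = α ∨ γ = β) → H.Misses c w γ → K.degree w ≤ 1 := by
      intro w γ hγ hw
      rw [← hcard]
      have hsub : (K.neighborFinset w).image (fun u => c s(w, u)) ⊆
          ({α, β} : Finset κ).erase γ := by
        intro δ hδ
        refine Finset.mem_erase.2 ⟨?_, hcol w hδ⟩
        obtain ⟨u, hu, rfl⟩ := Finset.mem_image.1 hδ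
        have hu : K.Adj w u := by simpa using hu
        exact hw u hu.1
      refine (Finset.card_le_card hsub).trans ?_
      rw [Finset.card_erase_of_mem (by simpa using hγ)]
      have := Finset.card_le_two (a := α) (b := β)
      omega
    refine Connected.false_of_three_le_one_degree _ hconn (fun w => (hle w).trans (h2 w))
      (a := ⟨x, hmem x (Reachable.refl x)⟩) (b := ⟨p, hmem p hpC⟩) (d := ⟨q, hmem q hqC⟩)
      (by simpa using hxp) (by simpa using hxq) (by simpa using hpq)
      ((hle _).trans (h1 x α (Or.inl rfl) hx)) ((hle _).trans (h1 p β (Or.inr rfl) hp))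
      ((hle _).trans (h1 q β (Or.inr rfl) hq))

open scoped Classical in
/-- The extension step of Vizing's theorem: if every vertex misses a colour, then one more edge `xy`
can be coloured. Otherwise the missing colours of the vertices reachable by fans from `y` all occur
at `x`, on edges to reachable vertices other than `y`, so that two reachable vertices miss the same
colour. A Kempe exchange at `x` then makes this colour available at `x` as well. -/
theorem IsEdgeColouring.extend [Fintype V] [Fintype κ] (hxy : x ≠ y) (hH : ¬ H.Adj x y)
    (hG : ∀ a b, G.Adj a b → H.Adj a b ∨ s(a, b) = s(x, y))
    (hdeg : ∀ v, H.degree v < Fintype.card κ) (hc : H.IsEdgeColouring c) :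
    ∃ c' : Sym2 V → κ, G.IsEdgeColouring c' := by
  by_contra hno
  have hfan : ∀ (c : Sym2 V → κ) (n : ℕ) (w : V) (γ : κ), H.IsEdgeColouring c →
      H.FanReach c x y n w → H.Misses c x γ → ¬ H.Misses c w γ := fun c n w γ hc hw hx hw' =>
    hno (exists_isEdgeColouring_of_fanReach hxy hH hG n c w γ hc hw hx hw')
  let Y : Finset V := Finset.univ.filter fun w => ∃ n, H.FanReach c x y n w
  have hyY : y ∈ Y := by simpa [Y] using ⟨0, rfl⟩
  choose f hf using fun w => exists_misses H c w (hdeg w)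
  -- the missing colour `f w` of a fan vertex is the colour of an edge from `x` to the fan
  have hz : ∀ w ∈ Y, ∃ z ∈ Y.erase y, H.Adj x z ∧ c s(x, z) = f w := by
    intro w hw
    obtain ⟨n, hn⟩ := (Finset.mem_filter.1 hw).2
    have hnot : ¬ H.Misses c x (f w) := fun h => hfan c n w (f w) hc hn h (hf w)
    simp only [Misses] at hnot
    push Not at hnot
    obtain ⟨z, hxz, hzw⟩ := hnot
    refine ⟨z, Finset.mem_erase.2 ⟨?_, ?_⟩, hxz, hzw⟩
    · rintro rfl
      exact hH hxz
    · simp only [Y, Finset.mem_filter, Finset.mem_univ, true_and]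
      exact ⟨n + 1, w, hn, hxz, by rw [hzw]; exact hf w⟩
  choose! g hgY hgx hgc using hz
  obtain ⟨p, hp, q, hq, hpq, hgpq⟩ := Finset.exists_ne_map_eq_of_card_lt_of_maps_to
    (Finset.card_erase_lt_of_mem hyY) (f := g) hgY
  have hfpq : f p = f q := by rw [← hgc p hp, ← hgc q hq, hgpq]
  have hYx : ∀ w ∈ Y, x ≠ w := by
    rintro w hw rfl
    obtain ⟨n, hn⟩ := (Finset.mem_filter.1 hw).2
    exact hfan c n x (f x) hc hn (hf x) (hf x)
  obtain ⟨C, hC, hxC, hpqC⟩ := hc.exists_isKempeClosed (f x) (f p) (hYx p hp) (hYx q hq) hpq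
    (hf x) (hf p) (by rw [hfpq]; exact hf q)
  have hxβ : H.Misses (kempeSwap c (f x) (f p) C) x (f p) := by
    have := hC.misses_of_mem hxC (hf x)
    rwa [Equiv.swap_apply_left] at this
  have hc' := hC.isEdgeColouring hc
  -- after the exchange, the fan either persists or is cut at a vertex that misses `f p`
  have key : ∀ n w, H.FanReach c x y n w → H.FanReach (kempeSwap c (f x) (f p) C) x y n w := by
    intro n
    induction n with
    | zero => exact fun w hw => hw
    | succ n ih =>
      rintro w ⟨w', hw', hxw, hm⟩
      refine ⟨w', ih w' hw', hxw, ?_⟩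
      have hα : c s(x, w) ≠ f x := hf x w hxw
      rw [hC.kempeSwap_apply hxw, if_pos hxC]
      by_cases hw'C : w' ∈ C
      · exact hC.misses_of_mem hw'C hm
      · by_cases hβ : c s(x, w) = f p
        · exact absurd (hC.misses_of_notMem hw'C (hβ ▸ hm)) (hfan _ n w' _ hc' (ih w' hw') hxβ)
        · rw [Equiv.swap_apply_of_ne_of_ne hα hβ]
          exact hC.misses_of_notMem hw'C hm
  obtain ⟨w, hwY, hwC, hwm⟩ : ∃ w ∈ Y, w ∉ C ∧ H.Misses c w (f p) := by
    by_cases h : p ∈ C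
    · exact ⟨q, hq, fun h' => hpqC ⟨h, h'⟩, hfpq ▸ hf q⟩
    · exact ⟨p, hp, h, hf p⟩
  obtain ⟨n, hn⟩ := (Finset.mem_filter.1 hwY).2
  exact hfan _ n w _ hc' (key n w hn) hxβ (hC.misses_of_notMem hwC hwm)

open scoped Classical in
/-- **Vizing's theorem**: a finite simple graph has a proper edge colouring with any set of more
than `Δ(G)` colours. -/
theorem exists_isEdgeColouring [Fintype V] [Fintype κ] (G : SimpleGraph V)
    (hdeg : ∀ v, G.degree v < Fintype.card κ) : ∃ c : Sym2 V → κ, G.IsEdgeColouring c := by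
  suffices h : ∀ (n : ℕ) (H : SimpleGraph V), H ≤ G → H.edgeFinset.card = n →
      ∃ c : Sym2 V → κ, H.IsEdgeColouring c from h _ G le_rfl rfl
  have hlt : ∀ H ≤ G, ∀ v, H.degree v < Fintype.card κ := fun H hHG v =>
    (degree_le_of_le hHG).trans_lt (hdeg v)
  intro n
  induction n with
  | zero =>
    intro H _ hn
    have hbot : H = ⊥ := by
      rw [Finset.card_eq_zero] at hn
      simpa using hn
    rcases isEmpty_or_nonempty V with hV | ⟨⟨v⟩⟩
    · exact ⟨fun e => isEmptyElim e.out.1, fun a => isEmptyElim a⟩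
    · obtain ⟨γ⟩ : Nonempty κ := Fintype.card_pos_iff.1 ((Nat.zero_le _).trans_lt (hdeg v))
      exact ⟨fun _ => γ, fun a b b' h => by simp [hbot] at h⟩
  | succ n ih =>
    intro H hHG hn
    obtain ⟨e, he⟩ : H.edgeFinset.Nonempty := Finset.card_pos.1 (by omega)
    induction e using Sym2.ind with
    | _ x y =>
    have hadj : H.Adj x y := by simpa using he
    have hle : H.deleteEdges {s(x, y)} ≤ H := deleteEdges_le _
    obtain ⟨c, hc⟩ := ih (H.deleteEdges {s(x, y)}) (hle.trans hHG) (by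
      have h1 : (H.edgeFinset.erase s(x, y)).card = n := by
        rw [Finset.card_erase_of_mem he, hn, Nat.add_sub_cancel]
      rw [← h1]
      congr 1
      ext e
      simp [and_comm])
    refine hc.extend hadj.ne (by simp) (G := H) ?_ (hlt _ (hle.trans hHG))
    intro a b hab
    by_cases h : s(a, b) = s(x, y)
    · exact Or.inr h
    · exact Or.inl (deleteEdges_adj.2 ⟨hab, h⟩)

end Vizing

end SimpleGraph

/-! ### Counting functions that avoid local events -/

section Counting

open Finset

variable {ι κ J : Type*}

open scoped Classical in
theorem card_filter_eq_off [Fintype ι] [DecidableEq ι] [Fintype κ] (T : Finset ι) (g : ι → κ) :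
    #{f : ι → κ | ∀ i ∉ T, f i = g i} = Fintype.card κ ^ #T := by
  have h : ({f : ι → κ | ∀ i ∉ T, f i = g i} : Finset (ι → κ)) =
      Fintype.piFinset fun i => if i ∈ T then univ else {g i} := by
    ext f
    simp only [mem_filter, mem_univ, true_and, Fintype.mem_piFinset]
    refine forall_congr' fun i => ?_
    split_ifs with hi <;> simp [hi]
  rw [h, Fintype.card_piFinset, ← prod_const, ← prod_subset (subset_univ T)]
  · exact prod_congr rfl fun i hi => by simp [hi]
  · intro i _ hi
    simp [hi]

open scoped Classical in
/-- Double counting of the pairs of functions that differ only on `T`, for a property `A` that does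
not depend on the values on `T`. -/
theorem card_mul_pow_eq_sum [Fintype ι] [DecidableEq ι] [Fintype κ] (T : Finset ι)
    (A B : (ι → κ) → Prop)
    (hA : ∀ f g : ι → κ, (∀ i ∉ T, g i = f i) → A f → A g) :
    #{f | A f ∧ B f} * Fintype.card κ ^ #T =
      ∑ f with A f, #{g : ι → κ | (∀ i ∉ T, g i = f i) ∧ B g} := by
  have h := sum_card_bipartiteAbove_eq_sum_card_bipartiteBelow
    (s := ({f | A f ∧ B f} : Finset (ι → κ))) (t := ({f | A f} : Finset (ι → κ)))
    (fun g f => ∀ i ∉ T, g i = f i)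
  have h1 : ∀ g ∈ ({f | A f ∧ B f} : Finset (ι → κ)),
      #(bipartiteAbove (fun g f => ∀ i ∉ T, g i = f i) ({f | A f} : Finset (ι → κ)) g) =
        Fintype.card κ ^ #T := by
    intro g hg
    rw [← card_filter_eq_off T g]
    congr 1
    ext f
    simp only [bipartiteAbove, mem_filter, mem_univ, true_and] at hg ⊢
    exact ⟨fun h i hi => (h.2 i hi).symm, fun h => ⟨hA g f h hg.1, fun i hi => (h i hi).symm⟩⟩
  rw [sum_congr rfl h1, sum_const, smul_eq_mul] at h
  rw [h]
  refine sum_congr rfl fun f hf => ?_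
  congr 1
  ext g
  simp only [bipartiteBelow, mem_filter, mem_univ, true_and] at hf ⊢
  exact ⟨fun h => ⟨h.2, h.1.2⟩, fun h => ⟨⟨hA f g h.1 hf, h.2⟩, h.1⟩⟩

/-- `f` satisfies the constraint `P` on `S` and avoids the events whose support lies in `S`. -/
def GoodOn (P : Finset ι → (ι → κ) → Prop) (E : J → Finset ι) (Q : J → (ι → κ) → Prop)
    (S : Finset ι) (f : ι → κ) : Prop :=
  P S f ∧ ∀ j, E j ⊆ S → ¬ Q j f

variable {P : Finset ι → (ι → κ) → Prop} {E : J → Finset ι} {Q : J → (ι → κ) → Prop}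

theorem GoodOn.anti (hanti : ∀ S S' f, S ⊆ S' → P S' f → P S f) {S S' : Finset ι} {f : ι → κ}
    (hS : S ⊆ S') (h : GoodOn P E Q S' f) : GoodOn P E Q S f :=
  ⟨hanti _ _ _ hS h.1, fun j hj => h.2 j (hj.trans hS)⟩

theorem GoodOn.congr (hloc : ∀ S (f g : ι → κ), (∀ i ∈ S, g i = f i) → P S f → P S g)
    (hQ : ∀ j (f g : ι → κ), (∀ i ∈ E j, g i = f i) → Q j f → Q j g) {S : Finset ι} {f g : ι → κ}
    (hfg : ∀ i ∈ S, g i = f i) (h : GoodOn P E Q S f) : GoodOn P E Q S g :=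
  ⟨hloc _ _ _ hfg h.1, fun j hj hq => h.2 j hj (hQ j g f (fun i hi => (hfg i (hj hi)).symm) hq)⟩

open scoped Classical in
/-- If each step of an extension process keeps a proportion `β / K` of the good functions, then
removing the constraints on `U` gains at most a factor `(K / β) ^ #U`. -/
theorem pow_mul_card_sdiff_le [DecidableEq ι] {n : Finset ι → ℕ} {β K m : ℕ}
    (hn : ∀ S, #S < m → ∀ e ∉ S, β * n S ≤ K * n (insert e S)) (S : Finset ι) (hS : #S ≤ m)
    (U : Finset ι) (hU : U ⊆ S) : β ^ #U * n (S \ U) ≤ K ^ #U * n S := by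
  induction U using Finset.induction_on with
  | empty => simp
  | insert u U hu ih =>
    have huS : u ∈ S := hU (mem_insert_self _ _)
    have h1 : insert u (S \ insert u U) = S \ U := by
      ext i
      by_cases hi : i = u
      · subst hi
        simp [huS, hu]
      · simp [hi]
    have hlt : #(S \ insert u U) < m := by
      refine lt_of_lt_of_le (card_lt_card ?_) hS
      exact ⟨sdiff_subset, fun h => by simpa using h huS⟩
    have h2 := hn _ hlt u (by simp)
    rw [h1] at h2
    rw [card_insert_of_notMem hu, pow_succ, pow_succ]
    calc β ^ #U * β * n (S \ insert u U) = β ^ #U * (β * n (S \ insert u U)) := by ring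
      _ ≤ β ^ #U * (K * n (S \ U)) := Nat.mul_le_mul_left _ h2
      _ = K * (β ^ #U * n (S \ U)) := by ring
      _ ≤ K * (K ^ #U * n S) := Nat.mul_le_mul_left _ (ih ((subset_insert _ _).trans hU))
      _ = K ^ #U * K * n S := by ring

open scoped Classical in
/-- A counting substitute for the local lemma. The values of `f : ι → κ` are subject to a hereditary
constraint `P` that always leaves at least `2β` choices for the next value, and to events `Q j`
with support `E j`. Given the values outside `T j`, at most `w` functions satisfy `Q j`,
and each index lies in the support of at most `N` events. If `K * N * w ≤ β ^ (t + 1)`, where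
`t = #(T j)`, then some function satisfies the constraint and avoids all events. -/
theorem exists_forall_not_of_counting [Fintype ι] [DecidableEq ι] [Fintype κ]
    [Fintype J] (T : J → Finset ι) (t w N β : ℕ)
    (hP0 : ∀ f, P ∅ f)
    (hanti : ∀ S S' f, S ⊆ S' → P S' f → P S f)
    (hloc : ∀ S (f g : ι → κ), (∀ i ∈ S, g i = f i) → P S f → P S g)
    (hext : ∀ S, ∀ e ∉ S, ∀ f, P S f → 2 * β ≤ #{γ | P (insert e S) (Function.update f e γ)})
    (hTE : ∀ j, T j ⊆ E j) (hT : ∀ j, #(T j) = t) (ht : 0 < t)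
    (hQ : ∀ j (f g : ι → κ), (∀ i ∈ E j, g i = f i) → Q j f → Q j g)
    (hw : ∀ j (f : ι → κ) (A : Finset (ι → κ)),
      (∀ g ∈ A, (∀ i ∉ T j, g i = f i) ∧ P (E j) g ∧ Q j g) → #A ≤ w)
    (hN : ∀ e, #{j | e ∈ E j} ≤ N)
    (hβ : 0 < β) (hβK : β ≤ Fintype.card κ)
    (hnum : Fintype.card κ * N * w ≤ β ^ (t + 1)) :
    ∃ f, P univ f ∧ ∀ j, ¬ Q j f := by
  set K := Fintype.card κ with hK
  have hKpos : 0 < K := hβ.trans_le hβK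
  let n : Finset ι → ℕ := fun S => #{f | GoodOn P E Q S f}
  have hstep : ∀ m, ∀ S, #S < m → ∀ e ∉ S, β * n S ≤ K * n (insert e S) := by
    intro m
    induction m with
    | zero => exact fun S hS => absurd hS (Nat.not_lt_zero _)
    | succ m ih =>
    intro S hS e he
    -- the good functions on `S` that keep the constraint at `e`
    have hkeep : 2 * β * n S ≤ K * #{f | GoodOn P E Q S f ∧ P (insert e S) f} := by
      have h := card_mul_pow_eq_sum {e} (fun f => GoodOn P E Q S f) (fun f => P (insert e S) f)
        (fun f g hfg => GoodOn.congr hloc hQ fun i hi => hfg i (by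
          rw [mem_singleton]
          rintro rfl
          exact he hi))
      rw [card_singleton, pow_one, mul_comm] at h
      rw [h, mul_comm, ← smul_eq_mul]
      refine card_nsmul_le_sum _ _ _ fun f hf => ?_
      refine (hext S e he f (mem_filter.1 hf).2.1).trans ?_
      refine card_le_card_of_injOn (fun γ => Function.update f e γ) ?_ ?_
      · intro γ hγ
        simp only [coe_filter, mem_univ, true_and, Set.mem_ofPred_eq, mem_singleton] at hγ ⊢
        exact ⟨fun i hi => Function.update_of_ne hi _ _, hγ⟩
      · intro γ _ γ' _ h
        simpa using congrFun h e
    let b : J → ℕ := fun j => #{f | GoodOn P E Q S f ∧ P (insert e S) f ∧ Q j f}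
    let I : Finset J := {j | e ∈ E j ∧ E j ⊆ insert e S}
    have hb : ∀ j ∈ I, β ^ t * b j ≤ w * n S := by
      intro j hj
      obtain ⟨hej, hjS⟩ := (mem_filter.1 hj).2
      have h1 : b j * K ^ t ≤ w * n (S \ T j) := by
        obtain ⟨R, hR⟩ : ∃ R : (ι → κ) → Prop, ∀ f, R f ↔ P (E j) f ∧ Q j f :=
          ⟨_, fun _ => Iff.rfl⟩
        have h2 : b j ≤ #{f | GoodOn P E Q (S \ T j) f ∧ R f} := by
          refine card_le_card fun f hf => ?_
          simp only [mem_filter, mem_univ, true_and, hR] at hf ⊢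
          exact ⟨hf.1.anti hanti sdiff_subset, hanti _ _ _ hjS hf.2.1, hf.2.2⟩
        have h3 := card_mul_pow_eq_sum (T j) (fun f => GoodOn P E Q (S \ T j) f) R
          (fun f g hfg => GoodOn.congr hloc hQ fun i hi => hfg i (mem_sdiff.1 hi).2)
        rw [hT j, ← hK] at h3
        refine (Nat.mul_le_mul_right _ h2).trans (h3.le.trans ?_)
        rw [mul_comm w, ← smul_eq_mul]
        refine sum_le_card_nsmul _ _ _ fun f _ => ?_
        exact hw j f _ fun g hg => by simpa [hR] using hg
      have hU : (T j).erase e ⊆ S := by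
        intro i hi
        obtain ⟨hie, hiT⟩ := mem_erase.1 hi
        exact (mem_insert.1 (hjS (hTE j hiT))).resolve_left hie
      have hSU : S \ (T j).erase e = S \ T j := by
        ext i
        simp only [mem_sdiff, mem_erase]
        refine and_congr_right fun hi => not_congr (and_iff_right ?_)
        rintro rfl
        exact he hi
      have h4 := pow_mul_card_sdiff_le ih S (Nat.lt_succ_iff.1 hS) _ hU
      rw [hSU] at h4
      have h5 : β ^ t * n (S \ T j) ≤ K ^ t * n S := by
        by_cases heT : e ∈ T j
        · rw [card_erase_of_mem heT, hT j] at h4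
          obtain ⟨t, rfl⟩ : ∃ s, t = s + 1 := ⟨t - 1, by omega⟩
          rw [Nat.add_sub_cancel] at h4
          calc β ^ (t + 1) * n (S \ T j) = β * (β ^ t * n (S \ T j)) := by ring
            _ ≤ K * (K ^ t * n S) := Nat.mul_le_mul hβK h4
            _ = K ^ (t + 1) * n S := by ring
        · rwa [erase_eq_of_notMem heT, hT j] at h4
      refine Nat.le_of_mul_le_mul_left ?_ (pow_pos hKpos t)
      calc K ^ t * (β ^ t * b j) = β ^ t * (b j * K ^ t) := by ring
        _ ≤ β ^ t * (w * n (S \ T j)) := Nat.mul_le_mul_left _ h1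
        _ = w * (β ^ t * n (S \ T j)) := by ring
        _ ≤ w * (K ^ t * n S) := Nat.mul_le_mul_left _ h5
        _ = K ^ t * (w * n S) := by ring
    have hsplit : #{f | GoodOn P E Q S f ∧ P (insert e S) f} ≤ n (insert e S) + ∑ j ∈ I, b j := by
      have hsub : ({f | GoodOn P E Q S f ∧ P (insert e S) f} : Finset (ι → κ)) ⊆
          ({f | GoodOn P E Q (insert e S) f} : Finset (ι → κ)) ∪
            I.biUnion fun j => {f | GoodOn P E Q S f ∧ P (insert e S) f ∧ Q j f} := by
        intro f hf
        simp only [mem_filter, mem_univ, true_and, mem_union, mem_biUnion, I] at hf ⊢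
        by_contra hcon
        rw [not_or] at hcon
        refine hcon.1 ⟨hf.2, fun j hj hq => ?_⟩
        by_cases hej : e ∈ E j
        · exact hcon.2 ⟨j, ⟨hej, hj⟩, hf.1, hf.2, hq⟩
        · exact hf.1.2 j (fun i hi => (mem_insert.1 (hj hi)).resolve_left
            (by rintro rfl; exact hej hi)) hq
      refine (card_le_card hsub).trans ((card_union_le _ _).trans ?_)
      exact Nat.add_le_add_left card_biUnion_le _
    have hI : #I ≤ N := (card_le_card fun j hj => by
      simp only [mem_filter, mem_univ, true_and, I] at hj ⊢
      exact hj.1).trans (hN e)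
    have hsum : β ^ t * ∑ j ∈ I, b j ≤ N * (w * n S) := by
      rw [mul_sum]
      refine (sum_le_card_nsmul _ _ _ hb).trans ?_
      rw [smul_eq_mul]
      exact Nat.mul_le_mul_right _ hI
    have hbad : β ^ t * (K * ∑ j ∈ I, b j) ≤ β ^ t * (β * n S) :=
      calc β ^ t * (K * ∑ j ∈ I, b j) = K * (β ^ t * ∑ j ∈ I, b j) := by ring
        _ ≤ K * (N * (w * n S)) := Nat.mul_le_mul_left _ hsum
        _ = K * N * w * n S := by ring
        _ ≤ β ^ (t + 1) * n S := Nat.mul_le_mul_right _ hnum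
        _ = β ^ t * (β * n S) := by ring
    have hbad' := Nat.le_of_mul_le_mul_left hbad (pow_pos hβ t)
    have hfin := hkeep.trans (Nat.mul_le_mul_left K hsplit)
    rw [mul_add] at hfin
    have : 2 * β * n S = β * n S + β * n S := by ring
    omega
  have hE : ∀ j, (E j).Nonempty := fun j => by
    have : (T j).Nonempty := card_pos.1 (by rw [hT j]; exact ht)
    exact this.mono (hTE j)
  have hempty : 0 < n ∅ := by
    obtain ⟨γ⟩ : Nonempty κ := Fintype.card_pos_iff.1 hKpos
    refine card_pos.2 ⟨fun _ => γ, ?_⟩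
    simp only [mem_filter, mem_univ, true_and]
    exact ⟨hP0 _, fun j hj => absurd (hE j) (not_nonempty_iff_eq_empty.2 (subset_empty.1 hj))⟩
  have h := pow_mul_card_sdiff_le (hstep (#(univ : Finset ι))) univ le_rfl univ le_rfl
  rw [sdiff_self] at h
  have hpos : 0 < K ^ #(univ : Finset ι) * n univ :=
    (Nat.mul_pos (pow_pos hβ _) hempty).trans_le h
  obtain ⟨f, hf⟩ := card_pos.1 (Nat.pos_of_mul_pos_left hpos)
  have hf := (mem_filter.1 hf).2
  exact ⟨f, hf.1, fun j => hf.2 j (subset_univ _)⟩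

end Counting

/-! ### Vertex colourings with few conflicts, and Hall's theorem with capacities -/

namespace SimpleGraph

open Finset

open scoped Classical in
/-- Given a colouring `φ` of the edges, there is a proper vertex colouring for which every vertex
`v` has at most `B` neighbours `u` that have the same colour as the edge `uv`. The events
to avoid are that all vertices of a set of `B + 1` neighbours of `v` have the colour of their
edge to `v`. -/
theorem exists_vertexColouring {V κ : Type*} [Fintype V] [Fintype κ]
    {G : SimpleGraph V} (φ : Sym2 V → κ) {Δ β : ℕ} (B : ℕ)
    (hΔ : ∀ v, G.degree v ≤ Δ) (hβ : 0 < β) (hK : Δ + 2 * β ≤ Fintype.card κ)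
    (hnum : Fintype.card κ * (Δ * Δ.choose B) ≤ β ^ (B + 2)) :
    ∃ c : V → κ, (∀ u v, G.Adj u v → c u ≠ c v) ∧
      ∀ v, #{u ∈ G.neighborFinset v | c u = φ s(u, v)} ≤ B := by
  let J := {p : V × Finset V // p.2 ∈ powersetCard (B + 1) (G.neighborFinset p.1)}
  obtain ⟨c, hc, hQ⟩ := exists_forall_not_of_counting (ι := V) (κ := κ) (J := J)
    (P := fun S f => ∀ u ∈ S, ∀ v ∈ S, G.Adj u v → f u ≠ f v)
    (E := fun j => j.1.2) (Q := fun j f => ∀ u ∈ j.1.2, f u = φ s(u, j.1.1))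
    (fun j => j.1.2) (B + 1) 1 (Δ * Δ.choose B) β
    (fun f u hu => by simp at hu)
    (fun S S' f hS h u hu v hv => h u (hS hu) v (hS hv))
    (fun S f g hfg h u hu v hv => by rw [hfg u hu, hfg v hv]; exact h u hu v hv)
    (fun S e he f hf => by
      refine le_trans ?_ (card_le_card (s := univ \ (G.neighborFinset e).image f) ?_)
      · have h1 := le_card_sdiff ((G.neighborFinset e).image f) univ
        have h2 : #((G.neighborFinset e).image f) ≤ Δ := card_image_le.trans (by simpa using hΔ e)
        rw [card_univ] at h1
        omega
      · intro γ hγ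
        have hγ' : ∀ v, G.Adj e v → f v ≠ γ := by simpa using hγ
        simp only [mem_filter, mem_univ, true_and]
        intro u hu v hv huv
        by_cases hue : u = e
        · subst hue
          rw [Function.update_self, Function.update_of_ne huv.ne']
          exact (hγ' v huv).symm
        · by_cases hve : v = e
          · subst hve
            rw [Function.update_self, Function.update_of_ne hue]
            exact hγ' u huv.symm
          · rw [Function.update_of_ne hue, Function.update_of_ne hve]
            exact hf u ((mem_insert.1 hu).resolve_left hue) v
              ((mem_insert.1 hv).resolve_left hve) huv)
    (fun j => le_rfl) (fun j => (mem_powersetCard.1 j.2).2) (Nat.succ_pos B)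
    (fun j f g hfg h u hu => by rw [hfg u hu]; exact h u hu)
    (fun j f A hA => by
      refine card_le_one.2 fun g hg g' hg' => funext fun i => ?_
      by_cases hi : i ∈ j.1.2
      · rw [(hA g hg).2.2 i hi, (hA g' hg').2.2 i hi]
      · rw [(hA g hg).1 i hi, (hA g' hg').1 i hi])
    (fun e => by
      have hcard : #((G.neighborFinset e).sigma fun v => powersetCard B (G.neighborFinset v)) ≤
          Δ * Δ.choose B := by
        rw [card_sigma]
        refine (sum_le_card_nsmul _ _ (Δ.choose B) fun v _ => ?_).trans ?_
        · rw [card_powersetCard]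
          exact Nat.choose_le_choose _ (by simpa using hΔ v)
        · rw [smul_eq_mul]
          exact Nat.mul_le_mul_right _ (by simpa using hΔ e)
      refine le_trans ?_ hcard
      refine card_le_card_of_injOn (fun j => ⟨j.1.1, j.1.2.erase e⟩) ?_ ?_
      · rintro ⟨⟨v, T⟩, hT⟩ hj
        obtain ⟨hTN, hTc⟩ := mem_powersetCard.1 hT
        have he : e ∈ T := by simpa using hj
        have hev : G.Adj v e := by simpa using hTN he
        simp only [coe_sigma, Set.mem_sigma_iff, mem_coe, mem_powersetCard, mem_neighborFinset]
        refine ⟨hev.symm, (erase_subset _ _).trans hTN, ?_⟩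
        rw [card_erase_of_mem he]
        exact Nat.sub_eq_of_eq_add hTc
      · rintro ⟨⟨v, T⟩, hT⟩ hj ⟨⟨v', T'⟩, hT'⟩ hj' h
        have he : e ∈ T := by simpa using hj
        have he' : e ∈ T' := by simpa using hj'
        simp only [Sigma.mk.injEq, heq_eq_eq] at h
        obtain ⟨rfl, h⟩ := h
        have : T = T' := by rw [← insert_erase he, h, insert_erase he']
        subst this
        rfl)
    hβ (by omega) (by simpa using hnum)
  refine ⟨c, fun u v => hc u (mem_univ _) v (mem_univ _), fun v => ?_⟩
  by_contra! hlt
  obtain ⟨T, hT, hTc⟩ := exists_subset_card_eq (Nat.succ_le_of_lt hlt)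
  exact hQ ⟨(v, T), mem_powersetCard.2 ⟨hT.trans (filter_subset _ _), hTc⟩⟩
    fun u hu => (mem_filter.1 (hT hu)).2

end SimpleGraph

section HallChoice

open Finset

open scoped Classical in
/-- Hall's theorem with capacities: if every `v ∈ A` has at least `a` options and each option is
shared by at most `s * a` elements of `A`, then one can choose so that no option is taken more than
`s` times. -/
theorem exists_choice_card_fiber_le {V W : Type*} [Nonempty W] (N : V → Finset W)
    (A : Finset V) {a s : ℕ} (ha : 0 < a) (hN : ∀ v ∈ A, a ≤ #(N v))
    (hW : ∀ w, #{v ∈ A | w ∈ N v} ≤ s * a) :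
    ∃ f : V → W, (∀ v ∈ A, f v ∈ N v) ∧ ∀ w, #{v ∈ A | f v = w} ≤ s := by
  have hall : ∀ S : Finset A, #S ≤ #(S.biUnion fun v => N v ×ˢ range s) := by
    intro S
    have h1 : (S.biUnion fun v => N v ×ˢ range s) = (S.biUnion fun v => N v) ×ˢ range s := by
      ext ⟨w, i⟩
      simp only [mem_biUnion, mem_product]
      grind
    rw [h1, card_product, card_range]
    have h2 := sum_card_bipartiteAbove_eq_sum_card_bipartiteBelow
      (s := S) (t := S.biUnion fun v => N v) (fun (v : A) w => w ∈ N v)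
    have h3 : #S * a ≤ ∑ v ∈ S, #(bipartiteAbove (fun (v : A) w => w ∈ N v)
        (S.biUnion fun v => N v) v) := by
      rw [← smul_eq_mul]
      refine card_nsmul_le_sum _ _ _ fun v hv => (hN v v.2).trans (card_le_card fun w hw => ?_)
      exact mem_filter.2 ⟨mem_biUnion.2 ⟨v, hv, hw⟩, hw⟩
    have h4 : ∑ w ∈ S.biUnion fun v => N v, #(bipartiteBelow (fun (v : A) w => w ∈ N v) S w) ≤
        #(S.biUnion fun v => N v) * (s * a) := by
      rw [← smul_eq_mul]
      refine sum_le_card_nsmul _ _ _ fun w _ => le_trans ?_ (hW w)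
      refine card_le_card_of_injOn (fun v => v.1) ?_ (fun _ _ _ _ h => Subtype.ext h)
      intro v hv
      simp only [bipartiteBelow, coe_filter, Set.mem_ofPred_eq] at hv ⊢
      exact ⟨v.2, hv.2⟩
    have h5 : #S * a ≤ #(S.biUnion fun v => N v) * s * a := by
      rw [mul_assoc]
      exact h3.trans (h2.le.trans h4)
    exact Nat.le_of_mul_le_mul_right h5 ha
  obtain ⟨F, hF, hFN⟩ := (all_card_le_biUnion_card_iff_exists_injective _).1 hall
  simp only [mem_product, mem_range] at hFN
  obtain ⟨w₀⟩ := ‹Nonempty W›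
  refine ⟨fun v => if h : v ∈ A then (F ⟨v, h⟩).1 else w₀, fun v hv => ?_, fun w => ?_⟩
  · simpa [hv] using (hFN ⟨v, hv⟩).1
  · rw [← card_range s]
    refine card_le_card_of_injOn (fun v => if h : v ∈ A then (F ⟨v, h⟩).2 else 0) ?_ ?_
    · intro v hv
      have hvA : v ∈ A := (mem_filter.1 hv).1
      simpa [hvA] using (hFN ⟨v, hvA⟩).2
    · intro v hv v' hv' h
      obtain ⟨hvA, hvw⟩ := mem_filter.1 hv
      obtain ⟨hvA', hvw'⟩ := mem_filter.1 hv'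
      simp only [hvA, hvA', dif_pos] at h hvw hvw'
      have := hF (Prod.ext (hvw.trans hvw'.symm) h)
      simpa using this

open scoped Classical in
/-- Iterating `exists_choice_card_fiber_le`: each `v ∈ A` chooses `t` distinct options. -/
theorem exists_choice_card_eq {V W : Type*} [Nonempty W] (N : V → Finset W) (A : Finset V)
    {a s : ℕ} (ha : 0 < a) (hW : ∀ w, #{v ∈ A | w ∈ N v} ≤ s * a) (t : ℕ)
    (hN : ∀ v ∈ A, a + t ≤ #(N v)) :
    ∃ D : V → Finset W, (∀ v ∈ A, D v ⊆ N v ∧ #(D v) = t) ∧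
      ∀ w, #{v ∈ A | w ∈ D v} ≤ t * s := by
  induction t with
  | zero => exact ⟨fun _ => ∅, fun v _ => by simp, fun w => by simp⟩
  | succ t ih =>
    obtain ⟨D, hD, hDw⟩ := ih fun v hv => (Nat.le_succ _).trans (hN v hv)
    obtain ⟨f, hf, hfw⟩ := exists_choice_card_fiber_le (fun v => N v \ D v) A (a := a) (s := s) ha
      (fun v hv => by
        have := le_card_sdiff (D v) (N v)
        have := hN v hv
        have := (hD v hv).2
        omega)
      (fun w => (card_le_card fun v hv => by
        simp only [mem_filter, mem_sdiff] at hv ⊢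
        exact ⟨hv.1, hv.2.1⟩).trans (hW w))
    refine ⟨fun v => insert (f v) (D v), fun v hv => ?_, fun w => ?_⟩
    · obtain ⟨h1, h2⟩ := mem_sdiff.1 (hf v hv)
      exact ⟨insert_subset h1 (hD v hv).1, by rw [card_insert_of_notMem h2, (hD v hv).2]⟩
    · have hsub : {v ∈ A | w ∈ insert (f v) (D v)} ⊆
          {v ∈ A | w ∈ D v} ∪ {v ∈ A | f v = w} := by
        intro v hv
        simp only [mem_filter, mem_insert, mem_union] at hv ⊢
        rcases hv.2 with h | h
        · exact Or.inr ⟨hv.1, h.symm⟩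
        · exact Or.inl ⟨hv.1, h⟩
      refine (card_le_card hsub).trans ((card_union_le _ _).trans ?_)
      rw [Nat.succ_mul]
      exact Nat.add_le_add (hDw w) (hfw w)

end HallChoice

/-! ### Distinguishing pallets by recolouring flexible edges -/

namespace SimpleGraph

open Finset

open scoped Classical in
theorem card_walk_le_pow {V : Type*} [Fintype V] {G : SimpleGraph V} {Δ : ℕ}
    (hΔ : ∀ v, G.degree v ≤ Δ) (v : V) (n : ℕ) :
    #{u | ∃ p : G.Walk u v, p.length ≤ n} ≤ (Δ + 1) ^ n := by
  induction n with
  | zero =>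
    refine card_le_one.2 fun a ha b hb => ?_
    simp only [mem_filter, mem_univ, true_and, Nat.le_zero] at ha hb
    obtain ⟨p, hp⟩ := ha
    obtain ⟨q, hq⟩ := hb
    rw [Walk.eq_of_length_eq_zero hp, Walk.eq_of_length_eq_zero hq]
  | succ n ih =>
    have hsub : ({u | ∃ p : G.Walk u v, p.length ≤ n + 1} : Finset V) ⊆
        ({u | ∃ p : G.Walk u v, p.length ≤ n} : Finset V).biUnion
          fun w => insert w (G.neighborFinset w) := by
      intro u hu
      obtain ⟨p, hp⟩ := (mem_filter.1 hu).2
      cases p with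
      | nil => exact mem_biUnion.2 ⟨v, by simpa using ⟨Walk.nil, Nat.zero_le n⟩, by simp⟩
      | @cons _ w _ h q =>
        refine mem_biUnion.2 ⟨w, ?_, by simp [h.symm]⟩
        simp only [mem_filter, mem_univ, true_and]
        exact ⟨q, by simpa using hp⟩
    refine (card_le_card hsub).trans ((card_biUnion_le_card_mul _ _ (Δ + 1) fun w _ => ?_).trans ?_)
    · exact (card_insert_le _ _).trans (Nat.succ_le_succ (by simpa using hΔ w))
    · rw [pow_succ]
      exact Nat.mul_le_mul_right _ ih

open scoped Classical in
theorem card_isDistNeighbour_le {V : Type*} [Fintype V] {G : SimpleGraph V} {Δ : ℕ}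
    (hΔ : ∀ v, G.degree v ≤ Δ) (r : ℕ) (v : V) :
    #{u | G.IsDistNeighbour r v u} ≤ (Δ + 1) ^ r := by
  refine (card_le_card fun u hu => ?_).trans (card_walk_le_pow hΔ v r)
  simp only [mem_filter, mem_univ, true_and] at hu ⊢
  have hle := hu.2
  obtain ⟨p, hp⟩ := exists_walk_of_edist_ne_top
    (ne_top_of_le_ne_top (ENat.natCast_ne_top r) hle)
  refine ⟨p.reverse, ?_⟩
  rw [← hp] at hle
  simpa using hle

theorem IsDistNeighbour.symm {V : Type*} {G : SimpleGraph V} {r : ℕ} {u v : V}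
    (h : G.IsDistNeighbour r u v) : G.IsDistNeighbour r v u := by
  rwa [IsDistNeighbour, edist_comm]

theorem IsDistNeighbour.ne {V : Type*} {G : SimpleGraph V} {r : ℕ} {u v : V}
    (h : G.IsDistNeighbour r u v) : u ≠ v := by
  rintro rfl
  simpa using h.1

section Flexible

variable {V κ : Type*} {G : SimpleGraph V}

/-- The total colouring with vertex colours `c` in which the edges in `X` are coloured by `f` and
all other edges by `φ`. -/
noncomputable def flexColouring (G : SimpleGraph V) (X : Finset (Sym2 V)) (c : V → κ)
    (φ f : Sym2 V → κ) : V ⊕ G.edgeSet → κ :=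
  open scoped Classical in Sum.elim c fun e => X.piecewise f φ e.1

open scoped Classical in
theorem mem_totalPallet_flexColouring {X : Finset (Sym2 V)} {c : V → κ} {φ f : Sym2 V → κ}
    {v : V} {a : κ} : a ∈ G.totalPallet (flexColouring G X c φ f) v ↔
      (∃ w, G.Adj v w ∧ X.piecewise f φ s(v, w) = a) ∨ a = c v := by
  constructor
  · rintro (⟨⟨e, he⟩, hv, rfl⟩ | h)
    · obtain ⟨w, rfl⟩ := hv
      exact Or.inl ⟨w, he, rfl⟩
    · exact Or.inr h
  · rintro (⟨w, hw, rfl⟩ | h)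
    · exact Or.inl ⟨⟨s(v, w), hw⟩, Sym2.mem_mk_left v w, rfl⟩
    · exact Or.inr h

theorem totalPallet_flexColouring_congr {X : Finset (Sym2 V)} {c : V → κ} {φ f g : Sym2 V → κ}
    {v : V} (h : ∀ e ∈ X, v ∈ e → g e = f e) :
    G.totalPallet (flexColouring G X c φ g) v = G.totalPallet (flexColouring G X c φ f) v := by
  classical
  ext a
  rw [mem_totalPallet_flexColouring, mem_totalPallet_flexColouring]
  have : ∀ w, X.piecewise g φ s(v, w) = X.piecewise f φ s(v, w) := by
    intro w
    by_cases hX : s(v, w) ∈ X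
    · simp [hX, h _ hX (Sym2.mem_mk_left v w)]
    · simp [hX]
  simp only [this]

/-- `γ` differs from the colours of the end vertices of `e` and from the colours of the edges
adjacent to `e`, where the flexible edges outside `S` count as uncoloured. -/
def Allowed (G : SimpleGraph V) (X : Finset (Sym2 V)) (c : V → κ) (φ : Sym2 V → κ)
    (S : Finset (Sym2 V)) (f : Sym2 V → κ) (e : Sym2 V) (γ : κ) : Prop :=
  open scoped Classical in
  ∀ v ∈ e, γ ≠ c v ∧ ∀ w, G.Adj v w → s(v, w) ≠ e → (s(v, w) ∈ X → s(v, w) ∈ S) →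
    γ ≠ X.piecewise f φ s(v, w)

/-- The flexible edges in `S` have colours from their lists that are compatible with all
colours assigned so far. -/
def FlexProper (G : SimpleGraph V) (X : Finset (Sym2 V)) (c : V → κ) (φ : Sym2 V → κ)
    (L : Sym2 V → Finset κ) (S : Finset (Sym2 V)) (f : Sym2 V → κ) : Prop :=
  ∀ e ∈ X, e ∈ S → f e ∈ L e ∧ Allowed G X c φ S f e (f e)

variable {X : Finset (Sym2 V)} {c : V → κ} {φ : Sym2 V → κ} {L : Sym2 V → Finset κ}

theorem FlexProper.anti (S S' : Finset (Sym2 V)) (f : Sym2 V → κ) (hS : S ⊆ S')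
    (h : FlexProper G X c φ L S' f) : FlexProper G X c φ L S f := by
  intro e heX heS
  obtain ⟨h1, h2⟩ := h e heX (hS heS)
  refine ⟨h1, fun v hv => ⟨(h2 v hv).1, fun w hw hne hin => (h2 v hv).2 w hw hne fun hX => ?_⟩⟩
  exact hS (hin hX)

theorem FlexProper.congr (S : Finset (Sym2 V)) (f g : Sym2 V → κ) (hfg : ∀ e ∈ S, g e = f e)
    (h : FlexProper G X c φ L S f) : FlexProper G X c φ L S g := by
  classical
  intro e heX heS
  obtain ⟨h1, h2⟩ := h e heX heS
  rw [hfg e heS]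
  refine ⟨h1, fun v hv => ⟨(h2 v hv).1, fun w hw hne hin => ?_⟩⟩
  have h3 := (h2 v hv).2 w hw hne hin
  by_cases hX : s(v, w) ∈ X
  · simpa [hX, hfg _ (hin hX)] using h3
  · simpa [hX] using h3

open scoped Classical in
theorem FlexProper.update (hX : ∀ e ∈ X, e ∈ G.edgeSet) {S : Finset (Sym2 V)} {f : Sym2 V → κ}
    (h : FlexProper G X c φ L S f) {e : Sym2 V} (he : e ∉ S) {γ : κ}
    (hγ : e ∈ X → γ ∈ L e ∧ Allowed G X c φ S f e γ) :
    FlexProper G X c φ L (insert e S) (Function.update f e γ) := by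
  have hpw : ∀ e', (e' ∈ X → e' ≠ e) →
      X.piecewise (Function.update f e γ) φ e' = X.piecewise f φ e' := by
    intro e' he'
    by_cases h' : e' ∈ X
    · simp [h', Function.update_of_ne (he' h')]
    · simp [h']
  intro e' he'X he'S
  by_cases hee : e' = e
  · subst hee
    rw [Function.update_self]
    obtain ⟨h1, h2⟩ := hγ he'X
    refine ⟨h1, fun v hv => ⟨(h2 v hv).1, fun w hw hne hin => ?_⟩⟩
    rw [hpw _ fun _ => hne]
    exact (h2 v hv).2 w hw hne fun hw' => (mem_insert.1 (hin hw')).resolve_left hne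
  · have he'S' := (mem_insert.1 he'S).resolve_left hee
    obtain ⟨h1, h2⟩ := h e' he'X he'S'
    rw [Function.update_of_ne hee]
    refine ⟨h1, fun v hv => ⟨(h2 v hv).1, fun w hw hne hin => ?_⟩⟩
    by_cases hvw : s(v, w) ∈ X ∧ s(v, w) = e
    · obtain ⟨hvX, rfl⟩ := hvw
      obtain ⟨w', rfl⟩ := hv
      have h3 := ((hγ hvX).2 v (Sym2.mem_mk_left v w)).2 w' (hX _ he'X) hee
        fun _ => he'S'
      simpa [hvX, he'X] using h3.symm
    · rw [hpw _ fun hX' hE => hvw ⟨hX', hE⟩]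
      refine (h2 v hv).2 w hw hne fun hX' => (mem_insert.1 (hin hX')).resolve_left ?_
      exact fun hE => hvw ⟨hX', hE⟩

/-- A proper choice of the colours of all flexible edges gives a proper total colouring. -/
theorem FlexProper.isProperTotalColouring [Fintype V]
    (hc : ∀ u v, G.Adj u v → c u ≠ c v)
    (hφ : ∀ a b b', G.Adj a b → G.Adj a b' → s(a, b) ∉ X → s(a, b') ∉ X → b ≠ b' →
      φ s(a, b) ≠ φ s(a, b'))
    (hcφ : ∀ a b, G.Adj a b → s(a, b) ∉ X → c a ≠ φ s(a, b)) {f : Sym2 V → κ}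
    (h : FlexProper G X c φ L univ f) :
    G.IsProperTotalColouring (flexColouring G X c φ f) := by
  classical
  refine ⟨hc, ?_, ?_⟩
  · rintro ⟨e, he⟩ ⟨e', he'⟩ hne ⟨v, hv, hv'⟩
    have hne : e ≠ e' := fun h => hne (Subtype.ext h)
    obtain ⟨w, rfl⟩ : ∃ w, e = s(v, w) := hv
    obtain ⟨w', rfl⟩ : ∃ w', e' = s(v, w') := hv'
    change X.piecewise f φ s(v, w) ≠ X.piecewise f φ s(v, w')
    by_cases h1 : s(v, w) ∈ X
    · have h3 := ((h _ h1 (mem_univ _)).2 v (Sym2.mem_mk_left v w)).2 w' he' hne.symm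
        fun _ => mem_univ _
      rwa [piecewise_eq_of_mem _ _ _ h1]
    · by_cases h2 : s(v, w') ∈ X
      · have h3 := ((h _ h2 (mem_univ _)).2 v (Sym2.mem_mk_left v w')).2 w he hne
          fun _ => mem_univ _
        rw [piecewise_eq_of_mem _ _ _ h2]
        exact h3.symm
      · rw [piecewise_eq_of_notMem _ _ _ h1, piecewise_eq_of_notMem _ _ _ h2]
        exact hφ v w w' he he' h1 h2 fun h => hne (by rw [h])
  · rintro v ⟨e, he⟩ hv
    obtain ⟨w, rfl⟩ : ∃ w, e = s(v, w) := hv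
    change c v ≠ X.piecewise f φ s(v, w)
    by_cases h1 : s(v, w) ∈ X
    · rw [piecewise_eq_of_mem _ _ _ h1]
      exact ((h _ h1 (mem_univ _)).2 v (Sym2.mem_mk_left v w)).1.symm
    · rw [piecewise_eq_of_notMem _ _ _ h1]
      exact hcφ v w he h1

open scoped Classical in
/-- If the colours of all edges outside a set `T` of flexible edges at `v` are given, then at most
`(#T)!` proper completions give `v` the same pallet as a vertex `u` that is not on these edges:
they permute the same set of colours. -/
theorem FlexProper.card_totalPallet_eq_le 
    (hX : ∀ e ∈ X, e ∈ G.edgeSet) {u v : V} {T E : Finset (Sym2 V)} (hTX : T ⊆ X) (hTE : T ⊆ E)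
    (hTv : ∀ e ∈ T, v ∈ e) (hTu : ∀ e ∈ T, u ∉ e) (hE : ∀ e ∈ X, v ∈ e → e ∈ E)
    (f : Sym2 V → κ) (A : Finset (Sym2 V → κ))
    (hA : ∀ g ∈ A, (∀ e ∉ T, g e = f e) ∧ FlexProper G X c φ L E g ∧
      G.totalPallet (flexColouring G X c φ g) v = G.totalPallet (flexColouring G X c φ g) u) :
    #A ≤ (#T).factorial := by
  rcases A.eq_empty_or_nonempty with h0 | ⟨g₀, hg₀⟩
  · simp [h0]
  have hinj : ∀ g ∈ A, Set.InjOn g T := by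
    intro g hg e he e' he' hee
    obtain ⟨-, hP, -⟩ := hA g hg
    by_contra hne
    obtain ⟨w, rfl⟩ := hTv e' he'
    have h := ((hP e (hTX he) (hTE he)).2 v (hTv e he)).2 w (hX _ (hTX he')) (Ne.symm hne)
      fun _ => hTE he'
    rw [piecewise_eq_of_mem _ _ _ (hTX he')] at h
    exact h hee
  have hmaps : ∀ g ∈ A, ∀ e ∈ T, g e ∈ T.image g₀ := by
    intro g hg e he
    obtain ⟨hoff, hP, hpal⟩ := hA g hg
    obtain ⟨hoff₀, -, hpal₀⟩ := hA g₀ hg₀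
    have hall := (hP e (hTX he) (hTE he)).2 v (hTv e he)
    have hmem : g e ∈ G.totalPallet (flexColouring G X c φ g) v := by
      rw [mem_totalPallet_flexColouring]
      obtain ⟨w, rfl⟩ := hTv e he
      exact Or.inl ⟨w, hX _ (hTX he), piecewise_eq_of_mem _ _ _ (hTX he)⟩
    rw [hpal, totalPallet_flexColouring_congr (f := g₀), ← hpal₀, mem_totalPallet_flexColouring]
      at hmem
    · rcases hmem with ⟨w, hw, hwe⟩ | hmem
      · by_cases hwT : s(v, w) ∈ T
        · rw [piecewise_eq_of_mem _ _ _ (hTX hwT)] at hwe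
          exact mem_image.2 ⟨_, hwT, hwe⟩
        · refine absurd ?_ (hall.2 w hw (fun h => hwT (h ▸ he)) fun hwX =>
            hE _ hwX (Sym2.mem_mk_left v w))
          rw [← hwe]
          by_cases hwX : s(v, w) ∈ X
          · rw [piecewise_eq_of_mem _ _ _ hwX, piecewise_eq_of_mem _ _ _ hwX, hoff _ hwT,
              hoff₀ _ hwT]
          · rw [piecewise_eq_of_notMem _ _ _ hwX, piecewise_eq_of_notMem _ _ _ hwX]
      · exact absurd hmem hall.1
    · intro e' _ hue'
      have he'T : e' ∉ T := fun h => hTu e' h hue'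
      rw [hoff _ he'T, hoff₀ _ he'T]
  have hcard : Fintype.card (T ↪ T.image g₀) = (#T).factorial := by
    rw [Fintype.card_embedding_eq, Fintype.card_coe, Fintype.card_coe,
      card_image_of_injOn (hinj g₀ hg₀), Nat.descFactorial_self]
  rw [← hcard, ← Fintype.card_coe]
  refine Fintype.card_le_of_injective (fun g => ⟨fun e => ⟨g.1 e.1, hmaps g.1 g.2 e.1 e.2⟩,
    fun e e' h => Subtype.ext (hinj g.1 g.2 e.2 e'.2 (by simpa using h))⟩) ?_
  intro g g' h
  refine Subtype.ext (funext fun e => ?_)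
  by_cases he : e ∈ T
  · have := DFunLike.congr_fun h ⟨e, he⟩
    exact Subtype.ext_iff.1 this
  · rw [(hA g.1 g.2).1 e he, (hA g'.1 g'.2).1 e he]

open scoped Classical in
/-- A partial total colouring of `G` extends to a total colouring that distinguishes all vertices
at distance at most `r`, provided that every vertex is on at least `r + 2` uncoloured edges and
that a list for each uncoloured edge always contains enough colours that cause no conflict. -/
theorem exists_isDistSetDistinguishing_of_lists [Fintype V] [Fintype κ] (r : ℕ) {Δ β : ℕ}
    (hΔ : ∀ v, G.degree v ≤ Δ) (hX : ∀ e ∈ X, e ∈ G.edgeSet)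
    (hc : ∀ u v, G.Adj u v → c u ≠ c v)
    (hφ : ∀ a b b', G.Adj a b → G.Adj a b' → s(a, b) ∉ X → s(a, b') ∉ X → b ≠ b' →
      φ s(a, b) ≠ φ s(a, b'))
    (hcφ : ∀ a b, G.Adj a b → s(a, b) ∉ X → c a ≠ φ s(a, b))
    (hXr : ∀ v, r + 2 ≤ #{e ∈ X | v ∈ e})
    (hL : ∀ (S : Finset (Sym2 V)) (f : Sym2 V → κ), (∀ e ∈ X, e ∈ S → f e ∈ L e) →
      ∀ e ∈ X, 2 * β ≤ #{γ ∈ L e | Allowed G X c φ S f e γ})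
    (hβ : 0 < β) (hβK : 2 * β ≤ Fintype.card κ)
    (hnum : Fintype.card κ * (4 * (Δ + 1) ^ r) * (r + 1).factorial ≤ β ^ (r + 2)) :
    ∃ C : V ⊕ G.edgeSet → κ, G.IsDistSetDistinguishing r C := by
  let J := {p : V × V // G.IsDistNeighbour r p.1 p.2}
  -- at most one of the `r + 2` flexible edges at `v` leads to `u`
  have hTex : ∀ j : J, ∃ T ⊆ ({e ∈ X | j.1.1 ∈ e ∧ j.1.2 ∉ e} : Finset (Sym2 V)),
      #T = r + 1 := by
    rintro ⟨⟨v, u⟩, hvu⟩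
    refine exists_subset_card_eq ?_
    have hsub : ({e ∈ X | v ∈ e} : Finset (Sym2 V)).erase s(v, u) ⊆ {e ∈ X | v ∈ e ∧ u ∉ e} := by
      intro e he
      simp only [mem_erase, mem_filter] at he ⊢
      refine ⟨he.2.1, he.2.2, fun hu => he.1 ?_⟩
      exact ((Sym2.mem_and_mem_iff hvu.ne).1 ⟨he.2.2, hu⟩)
    have h1 := card_le_card hsub
    have h2 := pred_card_le_card_erase (s := ({e ∈ X | v ∈ e} : Finset (Sym2 V))) (a := s(v, u))
    have h3 := hXr v
    change r + 1 ≤ #{e ∈ X | v ∈ e ∧ u ∉ e}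
    omega
  choose T hTsub hTcard using hTex
  have hT : ∀ j, ∀ e ∈ T j, e ∈ X ∧ j.1.1 ∈ e ∧ j.1.2 ∉ e := fun j e he =>
    mem_filter.1 (hTsub j he)
  obtain ⟨f, hf, hQ⟩ := exists_forall_not_of_counting (ι := Sym2 V) (κ := κ) (J := J)
    (P := FlexProper G X c φ L)
    (E := fun j => {e ∈ X | j.1.1 ∈ e ∨ j.1.2 ∈ e})
    (Q := fun j f => G.totalPallet (flexColouring G X c φ f) j.1.1 =
      G.totalPallet (flexColouring G X c φ f) j.1.2)
    T (r + 1) (r + 1).factorial (4 * (Δ + 1) ^ r) β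
    (fun f e _ he => absurd he (notMem_empty e))
    (fun S S' f hS h => FlexProper.anti S S' f hS h)
    (fun S f g hfg h => FlexProper.congr S f g hfg h)
    (fun S e he f hf => by
      by_cases heX : e ∈ X
      · refine (hL S f (fun e' h1 h2 => (hf e' h1 h2).1) e heX).trans (card_le_card fun γ hγ => ?_)
        simp only [mem_filter, mem_univ, true_and] at hγ ⊢
        exact hf.update hX he fun _ => hγ
      · refine hβK.trans (card_le_card fun γ _ => ?_)
        simp only [mem_filter, mem_univ, true_and]
        exact hf.update hX he fun h => absurd h heX)
    (fun j e he => by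
      obtain ⟨h1, h2, -⟩ := hT j e he
      exact mem_filter.2 ⟨h1, Or.inl h2⟩)
    hTcard (Nat.succ_pos r)
    (fun j f g hfg h => by
      rw [totalPallet_flexColouring_congr (f := f) fun e he hv =>
          hfg e (mem_filter.2 ⟨he, Or.inl hv⟩),
        totalPallet_flexColouring_congr (f := f) fun e he hv =>
          hfg e (mem_filter.2 ⟨he, Or.inr hv⟩)]
      exact h)
    (fun j f A hA => by
      rw [← hTcard j]
      refine FlexProper.card_totalPallet_eq_le hX (fun e he => (hT j e he).1) (fun e he => ?_)
        (fun e he => (hT j e he).2.1) (fun e he => (hT j e he).2.2) (fun e he hv => ?_) f A hA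
      · exact mem_filter.2 ⟨(hT j e he).1, Or.inl (hT j e he).2.1⟩
      · exact mem_filter.2 ⟨he, Or.inl hv⟩)
    (fun e => by
      induction e using Sym2.ind with
      | _ a b =>
      let B : V → Finset V := fun v => {u | G.IsDistNeighbour r v u}
      let F : Finset (V × V) := (({a, b} : Finset V).biUnion fun v => (B v).image fun u => (v, u)) ∪
        (({a, b} : Finset V).biUnion fun v => (B v).image fun u => (u, v))
      have hF : #F ≤ 4 * (Δ + 1) ^ r := by
        have h1 : ∀ h : V → V → V × V,
            #(({a, b} : Finset V).biUnion fun v => (B v).image (h v)) ≤ 2 * (Δ + 1) ^ r := fun h =>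
          (card_biUnion_le_card_mul _ _ ((Δ + 1) ^ r) fun v _ =>
            card_image_le.trans (card_isDistNeighbour_le hΔ r v)).trans
              (Nat.mul_le_mul_right _ card_le_two)
        have h2 := h1 fun v u => (v, u)
        have h3 := h1 fun v u => (u, v)
        refine (card_union_le _ _).trans ?_
        omega
      refine le_trans ?_ hF
      refine card_le_card_of_injOn (fun j => j.1) ?_ (fun _ _ _ _ h => Subtype.ext h)
      rintro ⟨⟨v, u⟩, hvu⟩ hj
      have hj : v ∈ s(a, b) ∨ u ∈ s(a, b) := by
        have := (mem_filter.1 hj).2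
        exact (mem_filter.1 this).2
      simp only [Sym2.mem_iff] at hj
      rcases hj with hj | hj
      · refine mem_union_left _ (mem_biUnion.2 ⟨v, by simpa using hj, mem_image.2 ⟨u, ?_, rfl⟩⟩)
        simpa [B] using hvu
      · refine mem_union_right _ (mem_biUnion.2 ⟨u, by simpa using hj, mem_image.2 ⟨v, ?_, rfl⟩⟩)
        simpa [B] using hvu.symm)
    hβ (by omega) hnum
  exact ⟨flexColouring G X c φ f, hf.isProperTotalColouring hc hφ hcφ,
    fun u v huv => hQ ⟨(u, v), huv⟩⟩

end Flexible

end SimpleGraph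

/-! ### The colouring with `Δ + 6β` colours -/

namespace SimpleGraph

open Finset

open scoped Classical in
/-- A distinguishing total colouring with `Δ + 6β` colours. The palette `Fin (Δ + 3β)` is used for
the vertices and most edges; the palette `Fin (3β)` only for those edges between vertices of degree
above `β - 2` that are in conflict with an end vertex or have been selected to be flexible. -/
theorem exists_isDistSetDistinguishing_sum {V : Type*} [Fintype V] [Nonempty V] (G : SimpleGraph V)
    {r Δ β B s : ℕ} (hΔ : ∀ v, G.degree v ≤ Δ) (hδ : ∀ v, r + 2 ≤ G.degree v)
    (hβ : 2 * r + 4 < β)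
    (hB : (Δ + 3 * β) * (Δ * Δ.choose B) ≤ β ^ (B + 2))
    (hs : Δ ≤ s * (β - (2 * r + 4)))
    (hF : 2 * (B + 1 + (r + 2) + (r + 2) * s) ≤ β)
    (hD : (Δ + 6 * β) * (4 * (Δ + 1) ^ r) * (r + 1).factorial ≤ β ^ (r + 2)) :
    ∃ C : V ⊕ G.edgeSet → Fin (Δ + 3 * β) ⊕ Fin (3 * β), G.IsDistSetDistinguishing r C := by
  obtain ⟨φ, hφ⟩ := exists_isEdgeColouring (κ := Fin (Δ + 3 * β)) G fun v => by
    have := hΔ v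
    rw [Fintype.card_fin]
    omega
  obtain ⟨c, hc, hcB⟩ := exists_vertexColouring φ B hΔ (β := β) (by omega)
    (by rw [Fintype.card_fin]; omega) (by rwa [Fintype.card_fin])
  -- every vertex of large degree with few neighbours of small degree selects `r + 2` edges
  -- to neighbours of large degree
  let N : V → Finset V := fun v => {w ∈ G.neighborFinset v | ¬ G.degree w + 2 ≤ β}
  let A : Finset V := {v | ¬ G.degree v + 2 ≤ β ∧ β - (2 * r + 4) + (r + 2) ≤ #(N v)}
  obtain ⟨D, hDN, hDw⟩ := exists_choice_card_eq N A (a := β - (2 * r + 4)) (s := s) (by omega)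
    (fun w => by
      refine le_trans ?_ ((hΔ w).trans hs)
      rw [← card_neighborFinset_eq_degree]
      refine card_le_card fun v hv => ?_
      have hv : w ∈ N v := (mem_filter.1 hv).2
      have hvw : G.Adj v w := by simpa using (mem_filter.1 hv).1
      simpa using hvw.symm) (r + 2) (fun v hv => (mem_filter.1 hv).2.2)
  -- the edges `ab` with `R a b` are in conflict with the colour of `a` or selected by `a`
  let Low : Sym2 V → Prop := fun e => ∃ v ∈ e, G.degree v + 2 ≤ β
  let R : V → V → Prop := fun a b => φ s(a, b) = c a ∨ (a ∈ A ∧ b ∈ D a)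
  let F : Sym2 V → Prop := fun e => e ∈ G.edgeSet ∧ ∃ a b, e = s(a, b) ∧ R a b
  let X : Finset (Sym2 V) := {e | e ∈ G.edgeSet ∧ (Low e ∨ F e)}
  let L : Sym2 V → Finset (Fin (Δ + 3 * β) ⊕ Fin (3 * β)) := fun e =>
    if Low e then univ.image Sum.inl else univ.image Sum.inr
  have hXmem : ∀ e, e ∈ X ↔ e ∈ G.edgeSet ∧ (Low e ∨ F e) := fun e => by simp [X]
  have hFdeg : ∀ v, #{w | F s(v, w)} ≤ B + 1 + (r + 2) + (r + 2) * s := by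
    intro v
    have hsub : ({w | F s(v, w)} : Finset V) ⊆
        ((({w ∈ G.neighborFinset v | c w = φ s(w, v)} : Finset V) ∪
          {w ∈ G.neighborFinset v | φ s(v, w) = c v}) ∪ (if v ∈ A then D v else ∅)) ∪
            {w ∈ A | v ∈ D w} := by
      intro w hw
      obtain ⟨hvw, a, b, hab, hR⟩ := (mem_filter.1 hw).2
      have hvw : w ∈ G.neighborFinset v := by simpa using hvw
      simp only [mem_union, mem_filter]
      rcases Sym2.eq_iff.1 hab with ⟨rfl, rfl⟩ | ⟨rfl, rfl⟩
      · rcases hR with hR | hR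
        · exact Or.inl (Or.inl (Or.inr ⟨hvw, hR⟩))
        · exact Or.inl (Or.inr (by rw [if_pos hR.1]; exact hR.2))
      · rcases hR with hR | hR
        · exact Or.inl (Or.inl (Or.inl ⟨hvw, hR.symm⟩))
        · exact Or.inr hR
    have h1 : #{w ∈ G.neighborFinset v | φ s(v, w) = c v} ≤ 1 := by
      refine card_le_one.2 fun w hw w' hw' => ?_
      obtain ⟨hw, hwc⟩ := mem_filter.1 hw
      obtain ⟨hw', hwc'⟩ := mem_filter.1 hw'
      exact hφ v w w' (by simpa using hw) (by simpa using hw') (hwc.trans hwc'.symm)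
    have h2 : #(if v ∈ A then D v else ∅) ≤ r + 2 := by
      split_ifs with hv
      · exact (hDN v hv).2.le
      · simp
    refine (card_le_card hsub).trans ((card_union_le _ _).trans (Nat.add_le_add ?_ (hDw v)))
    refine (card_union_le _ _).trans (Nat.add_le_add ?_ h2)
    exact (card_union_le _ _).trans (Nat.add_le_add (by convert hcB v) h1)
  refine exists_isDistSetDistinguishing_of_lists (X := X) (c := fun v => Sum.inl (c v))
    (φ := fun e => Sum.inl (φ e)) (L := L) (β := β) r hΔ (fun e he => ((hXmem e).1 he).1)
    (fun u v huv h => hc u v huv (Sum.inl_injective h))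
    (fun a b b' hab hab' _ _ hne h => hne (hφ a b b' hab hab' (Sum.inl_injective h))) ?_ ?_ ?_
    (by omega) ?_ ?_
  · intro a b hab hX h
    refine hX ((hXmem _).2 ⟨hab, Or.inr ⟨hab, a, b, rfl, Or.inl ?_⟩⟩)
    exact (Sum.inl_injective h).symm
  · intro v
    have key : ∀ M : Finset V, (∀ w ∈ M, s(v, w) ∈ X) → #M ≤ #{e ∈ X | v ∈ e} := by
      intro M hM
      refine card_le_card_of_injOn (fun w => s(v, w)) (fun w hw => ?_)
        (fun w _ w' _ h => Sym2.congr_right.1 h)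
      exact mem_filter.2 ⟨hM w hw, Sym2.mem_mk_left v w⟩
    by_cases hv : G.degree v + 2 ≤ β
    · refine (hδ v).trans ?_
      rw [← card_neighborFinset_eq_degree]
      refine key _ fun w hw => (hXmem _).2 ⟨by simpa using hw, Or.inl ⟨v, Sym2.mem_mk_left v w, hv⟩⟩
    · by_cases hlow : r + 2 ≤ #{w ∈ G.neighborFinset v | G.degree w + 2 ≤ β}
      · refine hlow.trans (key _ fun w hw => ?_)
        obtain ⟨hw, hwd⟩ := mem_filter.1 hw
        exact (hXmem _).2 ⟨by simpa using hw, Or.inl ⟨w, Sym2.mem_mk_right v w, hwd⟩⟩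
      · have hvA : v ∈ A := by
          refine mem_filter.2 ⟨mem_univ _, hv, ?_⟩
          have h1 := card_filter_add_card_filter_not (s := G.neighborFinset v)
            (fun w => G.degree w + 2 ≤ β)
          rw [card_neighborFinset_eq_degree] at h1
          change _ ≤ #{w ∈ G.neighborFinset v | ¬ G.degree w + 2 ≤ β}
          omega
        obtain ⟨hsub, hcard⟩ := hDN v hvA
        rw [← hcard]
        refine key _ fun w hw => ?_
        have hvw : G.Adj v w := by simpa using (mem_filter.1 (hsub hw)).1
        exact (hXmem _).2 ⟨hvw, Or.inr ⟨hvw, v, w, rfl, Or.inr ⟨hvA, hw⟩⟩⟩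
  · intro S f hf e he
    -- it suffices to exhibit at most `#(L e) - 2 * β` forbidden colours
    have key : ∀ Z : Finset (Fin (Δ + 3 * β) ⊕ Fin (3 * β)), 2 * β + #Z ≤ #(L e) →
        (∀ γ ∈ L e, γ ∉ Z → Allowed G X (fun v => Sum.inl (c v)) (fun e => Sum.inl (φ e)) S f e γ) →
        2 * β ≤ #{γ ∈ L e | Allowed G X (fun v => Sum.inl (c v)) (fun e => Sum.inl (φ e))
          S f e γ} := by
      intro Z hZ hal
      have h1 : L e \ Z ⊆ {γ ∈ L e | Allowed G X (fun v => Sum.inl (c v))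
          (fun e => Sum.inl (φ e)) S f e γ} := by
        intro γ hγ
        obtain ⟨h1, h2⟩ := mem_sdiff.1 hγ
        exact mem_filter.2 ⟨h1, hal γ h1 h2⟩
      have h2 := card_le_card h1
      have h3 := le_card_sdiff Z (L e)
      omega
    obtain ⟨heG, heX⟩ := (hXmem e).1 he
    by_cases hlow : Low e
    · have hLe : #(L e) = Δ + 3 * β := by
        simp [L, hlow, card_image_of_injective _ Sum.inl_injective]
      obtain ⟨a, ⟨b, rfl⟩, ha⟩ := hlow
      let p : V → V → Fin (Δ + 3 * β) ⊕ Fin (3 * β) := fun v w =>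
        X.piecewise f (fun e => Sum.inl (φ e)) s(v, w)
      refine key (({Sum.inl (c a), Sum.inl (c b)} ∪ (G.neighborFinset a).image (p a)) ∪
        (G.neighborFinset b).image (p b)) ?_ ?_
      · have h1 : #((G.neighborFinset a).image (p a)) ≤ G.degree a := card_image_le
        have h2 : #((G.neighborFinset b).image (p b)) ≤ G.degree b := card_image_le
        have h3 := card_union_le (({Sum.inl (c a), Sum.inl (c b)} : Finset _) ∪
          (G.neighborFinset a).image (p a)) ((G.neighborFinset b).image (p b))
        have h4 := card_union_le ({Sum.inl (c a), Sum.inl (c b)} : Finset _)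
          ((G.neighborFinset a).image (p a))
        have h5 : #({Sum.inl (c a), Sum.inl (c b)} : Finset (Fin (Δ + 3 * β) ⊕ Fin (3 * β))) ≤ 2 :=
          card_le_two
        have h6 := hΔ b
        omega
      · intro γ _ hγ v hv
        simp only [mem_union, mem_insert, mem_singleton, mem_image, mem_neighborFinset,
          not_or, not_exists, not_and] at hγ
        obtain ⟨⟨⟨h1, h2⟩, h3⟩, h4⟩ := hγ
        rcases Sym2.mem_iff.1 hv with rfl | rfl
        · exact ⟨h1, fun w hw _ _ h => h3 w hw h.symm⟩
        · exact ⟨h2, fun w hw _ _ h => h4 w hw h.symm⟩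
    -- only other edges coloured from the second palette can cause a conflict
    · have hLe : L e = univ.image Sum.inr := by simp [L, hlow]
      have hLc : #(L e) = 3 * β := by
        simp [hLe, card_image_of_injective _ Sum.inr_injective]
      induction e using Sym2.ind with
      | _ a b =>
      refine key ((({w | F s(a, w)} : Finset V).image fun w => f s(a, w)) ∪
        (({w | F s(b, w)} : Finset V).image fun w => f s(b, w))) ?_ ?_
      · have h1 : #((({w | F s(a, w)} : Finset V).image fun w => f s(a, w))) ≤ _ :=
          card_image_le.trans (hFdeg a)
        have h2 : #((({w | F s(b, w)} : Finset V).image fun w => f s(b, w))) ≤ _ :=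
          card_image_le.trans (hFdeg b)
        have h3 := card_union_le (({w | F s(a, w)} : Finset V).image fun w => f s(a, w))
          (({w | F s(b, w)} : Finset V).image fun w => f s(b, w))
        omega
      · intro γ hγ hγZ v hv
        rw [hLe] at hγ
        obtain ⟨i, -, rfl⟩ := mem_image.1 hγ
        refine ⟨Sum.inr_ne_inl, fun w _ _ hwS h => ?_⟩
        by_cases hwX : s(v, w) ∈ X
        · rw [piecewise_eq_of_mem _ _ _ hwX] at h
          have hfL := hf _ hwX (hwS hwX)
          rw [← h] at hfL
          have hnl : ¬ Low s(v, w) := fun hl => by simp [L, hl] at hfL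
          have hFvw := ((hXmem _).1 hwX).2.resolve_left hnl
          refine hγZ (mem_union.2 ?_)
          rcases Sym2.mem_iff.1 hv with rfl | rfl
          · exact Or.inl (mem_image.2 ⟨w, by simpa using hFvw, h.symm⟩)
          · exact Or.inr (mem_image.2 ⟨w, by simpa using hFvw, h.symm⟩)
        · rw [piecewise_eq_of_notMem _ _ _ hwX] at h
          exact Sum.inr_ne_inl h
  · rw [Fintype.card_sum, Fintype.card_fin, Fintype.card_fin]
    omega
  · rw [Fintype.card_sum, Fintype.card_fin, Fintype.card_fin]
    have : Δ + 3 * β + 3 * β = Δ + 6 * β := by omega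
    rwa [this]

/-- Renaming the colours injectively preserves distinguishing total colourings. -/
theorem IsDistSetDistinguishing.comp {V α α' : Type*} {G : SimpleGraph V} {r : ℕ}
    {C : V ⊕ G.edgeSet → α} (h : G.IsDistSetDistinguishing r C) {g : α → α'}
    (hg : Function.Injective g) : G.IsDistSetDistinguishing r (g ∘ C) := by
  have hp : ∀ v, G.totalPallet (g ∘ C) v = g '' G.totalPallet C v := by
    intro v
    ext a
    constructor
    · rintro (⟨e, he, rfl⟩ | h)
      · exact ⟨_, Or.inl ⟨e, he, rfl⟩, rfl⟩
      · exact ⟨_, Or.inr rfl, (Set.mem_singleton_iff.1 h).symm⟩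
    · rintro ⟨_, ⟨e, he, rfl⟩ | h, rfl⟩
      · exact Or.inl ⟨e, he, rfl⟩
      · rw [Set.mem_singleton_iff.1 h]
        exact Or.inr rfl
  refine ⟨⟨fun u v huv => hg.ne (h.1.1 u v huv), fun e f hef hv => hg.ne (h.1.2 e f hef hv),
    fun v e hv => hg.ne (h.1.3 v e hv)⟩, fun u v huv heq => h.2 u v huv ?_⟩
  rw [hp, hp] at heq
  exact hg.image_injective heq

theorem distSetTotalNumber_le_of_card_le {V α : Type*} [Fintype α] {G : SimpleGraph V} {r k : ℕ}
    {C : V ⊕ G.edgeSet → α} (h : G.IsDistSetDistinguishing r C) (hk : Fintype.card α ≤ k) :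
    G.distSetTotalNumber r ≤ k := by
  obtain ⟨g⟩ : Nonempty (α ↪ Fin k) := Function.Embedding.nonempty_of_card_le (by simpa using hk)
  exact Nat.sInf_le ⟨_, h.comp g.injective⟩

open scoped Classical in
/-- The edges at a vertex have pairwise different colours. -/
theorem degree_le_distSetTotalNumber {V : Type*} [Fintype V] (G : SimpleGraph V) (r : ℕ) (v : V) :
    G.degree v ≤ G.distSetTotalNumber r := by
  obtain ⟨C, hC⟩ := G.exists_isDistSetDistinguishing_distSetTotalNumber r
  rw [← card_neighborSet_eq_degree]
  conv_rhs => rw [← Fintype.card_fin (G.distSetTotalNumber r)]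
  refine Fintype.card_le_of_injective (fun w : G.neighborSet v => C (Sum.inr ⟨s(v, w), w.2⟩)) ?_
  intro w w' h
  by_contra hne
  refine hC.1.edge_ne _ _ ?_ ⟨v, Sym2.mem_mk_left v w, Sym2.mem_mk_left v w'⟩ h
  intro he
  exact hne (Subtype.ext (Sym2.congr_right.1 (Subtype.ext_iff.1 he)))

end SimpleGraph

/-! ### Choice of the parameters -/

open Filter in
theorem eventually_mul_log_pow_le (C : ℝ) (k : ℕ) :
    ∀ᶠ n : ℕ in atTop, C * Real.log n ^ k ≤ n := by
  have h := (Real.isLittleO_pow_log_id_atTop (n := k)).const_mul_left C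
  have h1 := tendsto_natCast_atTop_atTop.eventually (h.bound one_pos)
  filter_upwards [h1] with n hn
  simpa using (le_abs_self _).trans hn

/-- The parameters for which the colouring with `Δ + 6β` colours exists. -/
theorem exists_parameters (r : ℕ) : ∃ Δ₀ : ℕ, ∀ Δ ≥ Δ₀, ∃ β B s : ℕ,
    (β : ℝ) ≤ Δ / (2 * Real.log Δ) ∧ 2 * r + 4 < β ∧
    (Δ + 3 * β) * (Δ * Δ.choose B) ≤ β ^ (B + 2) ∧
    Δ ≤ s * (β - (2 * r + 4)) ∧
    2 * (B + 1 + (r + 2) + (r + 2) * s) ≤ β ∧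
    (Δ + 6 * β) * (4 * (Δ + 1) ^ r) * (r + 1).factorial ≤ β ^ (r + 2) := by
  obtain ⟨Δ₀, h₀⟩ := Filter.eventually_atTop.1
    (((Real.tendsto_log_atTop.comp tendsto_natCast_atTop_atTop).eventually_ge_atTop (13 : ℝ)).and
    ((eventually_mul_log_pow_le 64 2).and ((eventually_mul_log_pow_le (8 * (3 * r + 9)) 3).and
    (eventually_mul_log_pow_le (16 * 2 ^ r * (r + 1).factorial * 4 ^ (r + 2)) (r + 2)))))
  refine ⟨max Δ₀ 1, fun Δ hΔ => ?_⟩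
  obtain ⟨hL, h2, h3, h4⟩ := h₀ Δ ((le_max_left _ _).trans hΔ)
  have hΔ1 : 1 ≤ Δ := (le_max_right _ _).trans hΔ
  have hx1 : (1 : ℝ) ≤ Δ := by exact_mod_cast hΔ1
  have hexp : Real.exp (Real.log Δ) = Δ := Real.exp_log (by linarith)
  simp only [Function.comp_apply] at hL
  set x : ℝ := (Δ : ℝ) with hx
  set L : ℝ := Real.log x with hLdef
  have hL0 : 0 < L := by linarith
  have hr0 : (0 : ℝ) ≤ r := Nat.cast_nonneg r
  have hL3 : L ≤ L ^ 3 := le_self_pow₀ (by linarith) (by norm_num)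
  have hxL : 72 * L ≤ x := by nlinarith [pow_pos hL0 3, mul_nonneg hr0 (pow_pos hL0 3).le]
  have hβle : (⌊x / (2 * L)⌋₊ : ℝ) ≤ x / (2 * L) := Nat.floor_le (by positivity)
  have hβge : x / (4 * L) ≤ (⌊x / (2 * L)⌋₊ : ℝ) := by
    have h5 := (Nat.sub_one_lt_floor (x / (2 * L))).le
    have h6 : x / (2 * L) = x / (4 * L) + x / (4 * L) := by field_simp; norm_num
    have h7 : 1 ≤ x / (4 * L) := by rw [le_div_iff₀ (by positivity)]; linarith
    linarith
  set β : ℕ := ⌊x / (2 * L)⌋₊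
  have hβx : (β : ℝ) ≤ x / 2 := hβle.trans (div_le_div_of_nonneg_left (by linarith) (by norm_num)
    (by linarith))
  have hBge : L ^ 2 ≤ (⌈L ^ 2⌉₊ : ℝ) := Nat.le_ceil _
  have hBle : (⌈L ^ 2⌉₊ : ℝ) ≤ 2 * L ^ 2 := by
    have := (Nat.ceil_lt_add_one (sq_nonneg L)).le
    nlinarith
  set B : ℕ := ⌈L ^ 2⌉₊
  have hbase : 2 * (3 * r + 9) * L ^ 2 ≤ x / (4 * L) := by
    rw [le_div_iff₀ (by positivity)]
    linarith
  have hrβ : 2 * (2 * (r : ℝ) + 4) < β := by nlinarith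
  have hrβ' : 2 * (2 * r + 4) < β := by exact_mod_cast hrβ
  refine ⟨β, B, B, hβle, by omega, ?_, ?_, ?_, ?_⟩
  · -- `B! ≥ 4 (4 L) ^ (B + 2)` because `y ^ B / B! ≤ exp y` for `y = 4 e L`
    have hfac : 4 * (4 * L) ^ (B + 2) ≤ (B.factorial : ℝ) := by
      have h5 := Real.pow_div_factorial_le_exp (4 * L * Real.exp 1) (by positivity) B
      rw [div_le_iff₀ (by positivity), mul_pow, ← Real.exp_nat_mul, mul_one] at h5
      have h6 : 64 * L ^ 2 * Real.exp (4 * L * Real.exp 1) ≤ Real.exp B := by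
        calc 64 * L ^ 2 * Real.exp (4 * L * Real.exp 1)
            ≤ Real.exp L * Real.exp (12 * L) := by
              rw [hexp]
              refine mul_le_mul h2 (Real.exp_le_exp.2 ?_) (Real.exp_pos _).le (by linarith)
              nlinarith [Real.exp_one_lt_d9]
          _ = Real.exp (13 * L) := by rw [← Real.exp_add]; ring_nf
          _ ≤ Real.exp B := Real.exp_le_exp.2 (by nlinarith)
      refine le_of_mul_le_mul_right ?_ (Real.exp_pos (B : ℝ))
      calc 4 * (4 * L) ^ (B + 2) * Real.exp B
          = 64 * L ^ 2 * ((4 * L) ^ B * Real.exp B) := by ring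
        _ ≤ 64 * L ^ 2 * (Real.exp (4 * L * Real.exp 1) * B.factorial) :=
            mul_le_mul_of_nonneg_left h5 (by positivity)
        _ = 64 * L ^ 2 * Real.exp (4 * L * Real.exp 1) * B.factorial := by ring
        _ ≤ Real.exp B * B.factorial := mul_le_mul_of_nonneg_right h6 (by positivity)
        _ = B.factorial * Real.exp B := mul_comm _ _
    have hch : (Δ.choose B : ℝ) ≤ x ^ B / B.factorial := Nat.choose_le_pow_div B Δ
    have hmain : (x + 3 * β) * (x * (Δ.choose B : ℝ)) ≤ (β : ℝ) ^ (B + 2) :=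
      calc (x + 3 * β) * (x * (Δ.choose B : ℝ)) ≤ (4 * x) * (x * (x ^ B / B.factorial)) :=
            mul_le_mul (by linarith) (mul_le_mul_of_nonneg_left hch (by linarith)) (by positivity)
              (by linarith)
        _ = 4 * x ^ (B + 2) / B.factorial := by ring
        _ ≤ (x / (4 * L)) ^ (B + 2) := by
            rw [div_pow, div_le_div_iff₀ (by positivity) (by positivity)]
            calc 4 * x ^ (B + 2) * (4 * L) ^ (B + 2)
                = x ^ (B + 2) * (4 * (4 * L) ^ (B + 2)) := by ring
              _ ≤ x ^ (B + 2) * B.factorial := mul_le_mul_of_nonneg_left hfac (by positivity)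
        _ ≤ (β : ℝ) ^ (B + 2) := pow_le_pow_left₀ (by positivity) hβge _
    rw [hx] at hmain
    exact_mod_cast hmain
  · have h5 : x ≤ B * (β - (2 * r + 4)) :=
      calc x = 8 * L * (x / (8 * L)) := by field_simp
        _ ≤ L ^ 2 * (x / (8 * L)) := mul_le_mul_of_nonneg_right (by nlinarith) (by positivity)
        _ ≤ B * (β - (2 * r + 4)) := by
            have h6 : x / (8 * L) = x / (4 * L) / 2 := by field_simp; norm_num
            refine mul_le_mul hBge ?_ (by positivity) (by positivity)
            linarith
    have h7 : ((β - (2 * r + 4) : ℕ) : ℝ) = β - (2 * r + 4) := by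
      rw [Nat.cast_sub (by omega)]
      push_cast
      ring
    rw [← h7, hx] at h5
    exact_mod_cast h5
  · have h5 : 2 * ((B : ℝ) + 1 + (r + 2) + (r + 2) * B) ≤ β :=
      calc 2 * ((B : ℝ) + 1 + (r + 2) + (r + 2) * B) = 2 * ((r + 3) * (B + 1)) := by ring
        _ ≤ 2 * ((r + 3) * (3 * L ^ 2)) := by
            have : (B : ℝ) + 1 ≤ 3 * L ^ 2 := by nlinarith
            gcongr
        _ = 2 * (3 * r + 9) * L ^ 2 := by ring
        _ ≤ β := hbase.trans hβge
    exact_mod_cast h5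
  · have h5 : (x + 6 * β) * (4 * (x + 1) ^ r) * (r + 1).factorial ≤ (β : ℝ) ^ (r + 2) :=
      calc (x + 6 * β) * (4 * (x + 1) ^ r) * (r + 1).factorial
          ≤ (4 * x) * (4 * (2 * x) ^ r) * (r + 1).factorial := by
            refine mul_le_mul_of_nonneg_right (mul_le_mul (by linarith) ?_ (by positivity)
              (by positivity)) (by positivity)
            exact mul_le_mul_of_nonneg_left (pow_le_pow_left₀ (by linarith) (by linarith) _)
              (by norm_num)
        _ = x ^ (r + 1) * (16 * 2 ^ r * (r + 1).factorial) := by ring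
        _ ≤ (x / (4 * L)) ^ (r + 2) := by
            rw [div_pow, le_div_iff₀ (by positivity)]
            calc x ^ (r + 1) * (16 * 2 ^ r * (r + 1).factorial) * (4 * L) ^ (r + 2)
                = x ^ (r + 1) * (16 * 2 ^ r * (r + 1).factorial * 4 ^ (r + 2) * L ^ (r + 2)) := by
                  rw [mul_pow]; ring
              _ ≤ x ^ (r + 1) * x := mul_le_mul_of_nonneg_left h4 (by positivity)
              _ = x ^ (r + 2) := by ring
        _ ≤ (β : ℝ) ^ (r + 2) := pow_le_pow_left₀ (by positivity) hβge _
    rw [hx] at h5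
    exact_mod_cast h5

namespace SimpleGraph

/-- The explicit form of the bound: `Δ ≤ χ'' ≤ Δ + 3 Δ / ln Δ` for large `Δ`. -/
theorem exists_distSetTotalNumber_le (r : ℕ) : ∃ Δ₀ : ℕ, 2 ≤ Δ₀ ∧
    ∀ (V : Type u) [Fintype V] (G : SimpleGraph V) [DecidableRel G.Adj],
      Δ₀ ≤ G.maxDegree → r + 2 ≤ G.minDegree →
        G.maxDegree ≤ G.distSetTotalNumber r ∧
        (G.distSetTotalNumber r : ℝ) ≤
          G.maxDegree + 3 * (G.maxDegree / Real.log G.maxDegree) := by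
  classical
  obtain ⟨Δ₀, h⟩ := exists_parameters r
  refine ⟨max Δ₀ 2, le_max_right _ _, fun V _ G _ hΔ hδ => ?_⟩
  obtain ⟨β, B, s, hβle, hβ, hB, hs, hF, hD⟩ := h G.maxDegree ((le_max_left _ _).trans hΔ)
  have hne : Nonempty V := by
    by_contra hV
    rw [not_nonempty_iff] at hV
    have : G.maxDegree = 0 := by simp [maxDegree]
    have := (le_max_right Δ₀ 2).trans hΔ
    omega
  obtain ⟨v, hv⟩ := G.exists_maximal_degree_vertex
  obtain ⟨C, hC⟩ := exists_isDistSetDistinguishing_sum G (r := r) (Δ := G.maxDegree)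
    (fun v => by convert G.degree_le_maxDegree v)
    (fun v => (hδ.trans (G.minDegree_le_degree v)).trans_eq (by congr!)) hβ hB hs hF hD
  have hle : G.distSetTotalNumber r ≤ G.maxDegree + 6 * β :=
    distSetTotalNumber_le_of_card_le hC (by
      rw [Fintype.card_sum, Fintype.card_fin, Fintype.card_fin]
      omega)
  refine ⟨?_, ?_⟩
  · rw [hv]
    convert degree_le_distSetTotalNumber G r v
  · have hle' : (G.distSetTotalNumber r : ℝ) ≤ G.maxDegree + 6 * β := by exact_mod_cast hle
    have h1 : (G.maxDegree : ℝ) / (2 * Real.log G.maxDegree) =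
        G.maxDegree / Real.log G.maxDegree / 2 := by rw [mul_comm, div_div]
    rw [h1] at hβle
    linarith

end SimpleGraph

theorem mainTheorem2 (r : ℕ) (hr : 2 ≤ r) :
    (∃ Δ₀ : ℕ, ∀ (V : Type u) [Fintype V] (G : SimpleGraph V) [DecidableRel G.Adj],
      Δ₀ ≤ G.maxDegree → r + 2 ≤ G.minDegree →
        G.distSetTotalNumber r ≤
          ⌈(G.maxDegree : ℝ) / Real.log G.maxDegree ^ 4⌉₊ *
            (⌈Real.log G.maxDegree ^ 4⌉₊ + 5 * ⌈Real.log G.maxDegree ^ 3⌉₊ + 2)) ∧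
    (∀ ε : ℝ, 0 < ε → ∃ Δ₁ : ℕ,
      ∀ (V : Type u) [Fintype V] (G : SimpleGraph V) [DecidableRel G.Adj],
        Δ₁ ≤ G.maxDegree → r + 2 ≤ G.minDegree →
          |(G.distSetTotalNumber r : ℝ) - (G.maxDegree : ℝ)| ≤ ε * (G.maxDegree : ℝ)) := by
  obtain ⟨Δ₀, hΔ₀, h⟩ := SimpleGraph.exists_distSetTotalNumber_le.{u} r
  constructor
  · refine ⟨Δ₀, fun V _ G _ hΔ hδ => ?_⟩
    obtain ⟨-, hle⟩ := h V G hΔ hδ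
    have hx : (1 : ℝ) < G.maxDegree := by exact_mod_cast hΔ₀.trans hΔ
    have hL : 0 < Real.log G.maxDegree := Real.log_pos hx
    generalize hm : G.maxDegree = Δ at *
    set L := Real.log (Δ : ℝ)
    have hxL : 0 ≤ (Δ : ℝ) / L := by positivity
    have h1 : (Δ : ℝ) + 3 * (Δ / L) ≤
        ⌈(Δ : ℝ) / L ^ 4⌉₊ * (⌈L ^ 4⌉₊ + 5 * ⌈L ^ 3⌉₊ + 2) :=
      calc (Δ : ℝ) + 3 * (Δ / L) ≤ Δ + 5 * (Δ / L) := by linarith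
        _ = Δ / L ^ 4 * (L ^ 4 + 5 * L ^ 3) := by field_simp
        _ ≤ ⌈(Δ : ℝ) / L ^ 4⌉₊ * (⌈L ^ 4⌉₊ + 5 * ⌈L ^ 3⌉₊ + 2) := by
            refine mul_le_mul (Nat.le_ceil _) ?_ (by positivity) (by positivity)
            have h4 := Nat.le_ceil (L ^ 4)
            have h3 := Nat.le_ceil (L ^ 3)
            linarith
    have h2 := hle.trans h1
    exact_mod_cast h2
  · intro ε hε
    obtain ⟨Δ₁, h₁⟩ := Filter.eventually_atTop.1
      ((Real.tendsto_log_atTop.comp tendsto_natCast_atTop_atTop).eventually_ge_atTop (3 / ε))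
    refine ⟨max Δ₀ Δ₁, fun V _ G _ hΔ hδ => ?_⟩
    obtain ⟨hge, hle⟩ := h V G ((le_max_left _ _).trans hΔ) hδ
    have hL := h₁ G.maxDegree ((le_max_right _ _).trans hΔ)
    simp only [Function.comp_apply] at hL
    have hL0 : 0 < Real.log G.maxDegree := (by positivity : 0 < 3 / ε).trans_le hL
    have hge' : (G.maxDegree : ℝ) ≤ G.distSetTotalNumber r := by exact_mod_cast hge
    rw [abs_of_nonneg (by linarith)]
    have h3 : 3 * ((G.maxDegree : ℝ) / Real.log G.maxDegree) ≤ ε * G.maxDegree := by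
      rw [← mul_div_assoc, div_le_iff₀ hL0]
      rw [div_le_iff₀ hε] at hL
      nlinarith [Nat.cast_nonneg (α := ℝ) G.maxDegree]
    linarith
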